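/- Let $\Omega\subset\mathbb R^d$ be a bounded open set, let $\nu,C_s,\delta,\beta>0$, let $f\in L^\infty(0,\infty;L^2(\Omega)^d)$ and $w_0\in L^2(\Omega)^d$. Put $$\nu_T(w)=(C_s\delta)^2|\nabla w|,\qquad a(w)=\sqrt{\nu^{-1}\nu_T(w)}=\nu^{-1/2}C_s\delta\sqrt{|\nabla w|},$$ where $|\nabla w|$ is the Frobenius norm. Let $w$ be a strong solution of the corrected Smagorinsky model $$w_t+\beta^2a(w)\,\partial_t\big(a(w)w\big)+w\cdot\nabla w+\nabla p-\nabla\cdot\big([\nu+\nu_T(w)]\nabla w\big)=f,\qquad \nabla\cdot w=0\quad\text{in }\Omega\times(0,\infty),$$ $$w=0\ \text{on }\partial\Omega,\qquad w(\cdot,0)=w_0 .$$ Here *strong solution* means that for every $T<\infty$: $w\in L^\infty(0,T;W^{1,3}_0(\Omega)^d)$; $w$ and $a(w)w$ belong to $W^{1,2}(0,T;L^2(\Omega)^d)$, with $w(0)=w_0$; there is a pressure $p\in L^1(0,T;W^{1,3/2}(\Omega))$; the weak divergence $\nabla\cdot([\nu+\nu_T(w)]\nabla w)$ belongs to $L^1(0,T;L^{3/2}(\Omega)^d)$;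 and both equations hold almost everywhere in $\Omega\times(0,\infty)$. Let $$MD(t)=\int_\Omega \beta^2a(w)\,\partial_t\big(a(w)w\big)\cdot w+\nu_T(w)|\nabla w|^2\,dx .$$ A generalized limit $LIM_{T\to\infty}$ is a positive linear functional on the space of bounded real functions on $[0,\infty)$ which agrees with the ordinary limit as $T\to\infty$ whenever that limit exists. Then the integrands of $\int_0^T(f,w)\,dt$, $\int_0^T\int_\Omega[\nu+\nu_T(w)]|\nabla w|^2dx\,dt$ and $\int_0^TMD(t)\,dt$ are integrable on $(0,T)\times\Omega$ for every $T>0$, and: 1. $w,\ a(w)w\in L^\infty(0,\infty;L^2(\Omega)^d)$. 2. There is a constant $C<\infty$ independent of $T$ such that for all $T>0$ $$\frac1T\int_0^T\int_\Omega[\nu+\nu_T(w)]\nabla w:\nabla w\,dx\,dt\le C .$$ 3. The time averages below are bounded functions of $T$ and, for every generalized limit $LIM$, $$LIM_{T\to\infty}\frac1T\int_0^T\int_\Omega[\nu+\nu_T(w)]|\nabla w|^2dx\,dt=LIM_{T\to\infty}\frac1T\int_0^T(f,w)\,dt .$$ 4. $$0\le\liminf_{T\to\infty}\frac1T\int_0^TMD(t)\,dt\le\limsup_{T\to\infty}\frac1T\int_0^TMD(t)\,dt<\infty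 .$$ -/

import Mathlib

open MeasureTheory Set Filter Topology
open scoped ENNReal NNReal ContDiff

noncomputable section

namespace Smagorinsky

/-- Points of space and velocities: `ℝ^d` with the Euclidean norm. -/
abbrev Vec (d : ℕ) : Type := EuclideanSpace ℝ (Fin d)

/-- Velocity gradients. `G i` is the derivative in the `i`-th direction, so that `G i j = ∂ᵢ wⱼ`.
The norm of this type is the Frobenius norm `|G| = (∑ᵢⱼ (G i j)²)^(1/2)` and its inner product is
the double contraction `G : H = ∑ᵢⱼ (G i j) (H i j)`. -/
abbrev Tensor (d : ℕ) : Type := PiLp 2 (fun _ : Fin d => Vec d)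

variable {d : ℕ}

/-- The classical gradient of a vector field. -/
def grad (φ : Vec d → Vec d) (x : Vec d) : Tensor d :=
  WithLp.toLp 2 (fun i => fderiv ℝ φ x (EuclideanSpace.single i 1))

/-- The trace of a gradient, i.e. the divergence `∑ᵢ ∂ᵢ wᵢ`. -/
def trace (G : Tensor d) : ℝ := ∑ i, G i i

/-- The convective term `(w · ∇) w = ∑ᵢ wᵢ ∂ᵢ w`, for a velocity `v` and a gradient `G`. -/
def convection (v : Vec d) (G : Tensor d) : Vec d := ∑ i, v i • G i

/-- Test fields: `φ ∈ C_c^∞(Ω; ℝ^d)`. -/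
def IsTestField (Ω : Set (Vec d)) (φ : Vec d → Vec d) : Prop :=
  ContDiff ℝ ∞ φ ∧ HasCompactSupport φ ∧ tsupport φ ⊆ Ω

/-- `u ∈ W₀^{1,p}(Ω; ℝ^d)` and `∇u = G`: the pair `(u, G)` is a limit in `L^p(Ω)` of pairs
`(φₙ, ∇φₙ)` with test fields `φₙ`. -/
def MemW0 (Ω : Set (Vec d)) (p : ℝ≥0∞) (u : Vec d → Vec d) (G : Vec d → Tensor d) : Prop :=
  MemLp u p (volume.restrict Ω) ∧ MemLp G p (volume.restrict Ω) ∧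
  ∃ φ : ℕ → Vec d → Vec d, (∀ n, IsTestField Ω (φ n)) ∧
    Tendsto (fun n => eLpNorm (fun x => φ n x - u x) p (volume.restrict Ω)) atTop (𝓝 0) ∧
    Tendsto (fun n => eLpNorm (fun x => grad (φ n) x - G x) p (volume.restrict Ω)) atTop (𝓝 0)

/-- `u ∈ L^p(I; L^q(Ω; F))`. -/
def MemLpLq {F : Type*} [NormedAddCommGroup F] (I : Set ℝ) (Ω : Set (Vec d)) (p q : ℝ≥0∞)
    (u : ℝ → Vec d → F) : Prop :=
  AEStronglyMeasurable (fun z : ℝ × Vec d => u z.1 z.2)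
    ((volume.restrict I).prod (volume.restrict Ω)) ∧
  eLpNorm (fun t => eLpNorm (u t) q (volume.restrict Ω)) p (volume.restrict I) < ⊤

/-- `u ∈ L^p(0,T; L^q(Ω; F))` for every finite `T > 0`. -/
def LocMemLpLq {F : Type*} [NormedAddCommGroup F] (Ω : Set (Vec d)) (p q : ℝ≥0∞)
    (u : ℝ → Vec d → F) : Prop :=
  ∀ T : ℝ, 0 < T → MemLpLq (Ioo 0 T) Ω p q u

/-- `u ∈ W^{1,2}(0,T; L²(Ω))` for every finite `T > 0`, with `∂u/∂t = ut` and initial value `u₀`: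
`u` is (up to null sets) the absolutely continuous function `u(t) = u₀ + ∫₀ᵗ ut(s) ds` with values
in `L²(Ω)`, where `ut ∈ L²(0,T; L²(Ω))`. -/
def HasTimeDeriv (Ω : Set (Vec d)) (u₀ : Vec d → Vec d) (u ut : ℝ → Vec d → Vec d) : Prop :=
  MemLp u₀ 2 (volume.restrict Ω) ∧ LocMemLpLq Ω 2 2 ut ∧
  ∀ᵐ t ∂(volume.restrict (Ioi (0 : ℝ))), ∀ᵐ x ∂(volume.restrict Ω),
    u t x = u₀ x + ∫ s in (0 : ℝ)..t, ut s x

/-- `h` is the weak divergence in `Ω` of the tensor field `S`: `hⱼ = ∑ᵢ ∂ᵢ S i j`. -/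
def IsWeakDiv (Ω : Set (Vec d)) (S : Vec d → Tensor d) (h : Vec d → Vec d) : Prop :=
  ∀ φ : Vec d → Vec d, IsTestField Ω φ →
    ∫ x in Ω, inner ℝ (S x) (grad φ x) = - ∫ x in Ω, inner ℝ (h x) (φ x)

/-- `g` is the weak gradient in `Ω` of the scalar field `q`. -/
def IsWeakGrad (Ω : Set (Vec d)) (q : Vec d → ℝ) (g : Vec d → Vec d) : Prop :=
  ∀ φ : Vec d → Vec d, IsTestField Ω φ →
    ∫ x in Ω, q x * trace (grad φ x) = - ∫ x in Ω, inner ℝ (g x) (φ x)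

/-- The Smagorinsky turbulent viscosity `ν_T(w) = (C_s δ)² |∇w|`, as a function of `G = ∇w`. -/
def nuT (Cs δ : ℝ) (G : Tensor d) : ℝ := (Cs * δ) ^ 2 * ‖G‖

/-- `a(w) = (ν⁻¹ ν_T(w))^(1/2) = ν^(-1/2) C_s δ |∇w|^(1/2)`, as a function of `G = ∇w`. -/
def aCoef (ν Cs δ : ℝ) (G : Tensor d) : ℝ := Real.sqrt (ν⁻¹ * nuT Cs δ G)

/-- `w` is a strong solution on `Ω × (0,∞)`, with no-slip boundary conditions and `w(0) = w₀`, of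
`w_t + β² a(w) ∂ₜ(a(w) w) + w·∇w + ∇p - ∇·([ν + ν_T(w)] ∇w) = f`, `∇·w = 0`.
The gradient `Dw = ∇w` and the time derivative `Daw = ∂ₜ(a(w) w)` are determined by `w` up to null
sets. All the derivatives that occur are functions and the equation holds almost everywhere. -/
structure IsStrongSolution (Ω : Set (Vec d)) (ν Cs δ β : ℝ) (f : ℝ → Vec d → Vec d)
    (w₀ : Vec d → Vec d) (w : ℝ → Vec d → Vec d) (Dw : ℝ → Vec d → Tensor d)
    (Daw : ℝ → Vec d → Vec d) : Prop where
  /-- `w ∈ L^∞(0,T; L³)` for all `T`. -/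
  w_mem : LocMemLpLq Ω ⊤ 3 w
  /-- `∇w ∈ L^∞(0,T; L³)` for all `T`. -/
  Dw_mem : LocMemLpLq Ω ⊤ 3 Dw
  /-- `w(t) ∈ W₀^{1,3}(Ω)`, which contains the condition `w = 0` on `∂Ω`, with gradient `Dw(t)`. -/
  memW0 : ∀ᵐ t ∂(volume.restrict (Ioi (0 : ℝ))), MemW0 Ω 3 (w t) (Dw t)
  /-- `∇·w = 0`. -/
  div_free : ∀ᵐ t ∂(volume.restrict (Ioi (0 : ℝ))), ∀ᵐ x ∂(volume.restrict Ω),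
    trace (Dw t x) = 0
  /-- `Daw = ∂ₜ(a(w) w)`. -/
  aw_deriv : ∃ z₀ : Vec d → Vec d,
    HasTimeDeriv Ω z₀ (fun t x => aCoef ν Cs δ (Dw t x) • w t x) Daw
  /-- There are a time derivative `wt = w_t`, with `w(0) = w₀`, a pressure `p` with gradient `Dp`,
  and a divergence `h` of the viscous stress, with which the momentum equation holds. -/
  momentum : ∃ (wt : ℝ → Vec d → Vec d) (p : ℝ → Vec d → ℝ) (Dp h : ℝ → Vec d → Vec d),
    HasTimeDeriv Ω w₀ w wt ∧
    LocMemLpLq Ω 1 (3 / 2) p ∧ LocMemLpLq Ω 1 (3 / 2) Dp ∧ LocMemLpLq Ω 1 (3 / 2) h ∧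
    (∀ᵐ t ∂(volume.restrict (Ioi (0 : ℝ))), IsWeakGrad Ω (p t) (Dp t)) ∧
    (∀ᵐ t ∂(volume.restrict (Ioi (0 : ℝ))),
      IsWeakDiv Ω (fun x => (ν + nuT Cs δ (Dw t x)) • Dw t x) (h t)) ∧
    ∀ᵐ t ∂(volume.restrict (Ioi (0 : ℝ))), ∀ᵐ x ∂(volume.restrict Ω),
      wt t x + (β ^ 2 * aCoef ν Cs δ (Dw t x)) • Daw t x + convection (w t x) (Dw t x)
        + Dp t x - h t x = f t x

/-- The density `[ν + ν_T(w)] ∇w : ∇w` of the total dissipation. -/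
def dissDensity (ν Cs δ : ℝ) (G : Tensor d) : ℝ := (ν + nuT Cs δ G) * inner ℝ G G

/-- The density `β² a(w) ∂ₜ(a(w) w) · w + ν_T(w) |∇w|²` of the model dissipation, for
`G = ∇w`, `v = w` and `A = ∂ₜ(a(w) w)`. -/
def mdDensity (ν Cs δ β : ℝ) (G : Tensor d) (v A : Vec d) : ℝ :=
  β ^ 2 * aCoef ν Cs δ G * inner ℝ A v + nuT Cs δ G * ‖G‖ ^ 2

/-- The time average `(1/T) ∫₀ᵀ ∫_Ω ρ(t,x) dx dt`. -/
def timeAvg (Ω : Set (Vec d)) (ρ : ℝ → Vec d → ℝ) (T : ℝ) : ℝ :=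
  (1 / T) * ∫ t in (0 : ℝ)..T, ∫ x in Ω, ρ t x

/-- The bounded real functions on `[0,∞)`. -/
def boundedFunctions : Submodule ℝ (ℝ≥0 → ℝ) where
  carrier := {g | ∃ C : ℝ, ∀ T, |g T| ≤ C}
  add_mem' := by
    rintro g h ⟨C, hC⟩ ⟨D, hD⟩
    exact ⟨C + D, fun T => (abs_add_le _ _).trans (add_le_add (hC T) (hD T))⟩
  zero_mem' := ⟨0, fun T => by simp⟩
  smul_mem' := by
    rintro c g ⟨C, hC⟩
    refine ⟨|c| * C, fun T => ?_⟩
    simp only [Pi.smul_apply, smul_eq_mul, abs_mul]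
    exact mul_le_mul_of_nonneg_left (hC T) (abs_nonneg c)

/-- A generalized limit `LIM_{T→∞}`: a positive linear functional on the bounded functions on
`[0,∞)` that extends the ordinary limit as `T → ∞`. -/
structure GeneralizedLimit where
  /-- The linear functional. -/
  toLinearMap : boundedFunctions →ₗ[ℝ] ℝ
  nonneg : ∀ g : boundedFunctions, (∀ T, 0 ≤ (g : ℝ≥0 → ℝ) T) → 0 ≤ toLinearMap g
  eq_of_tendsto : ∀ (g : boundedFunctions) (l : ℝ),
    Tendsto (g : ℝ≥0 → ℝ) atTop (𝓝 l) → toLinearMap g = l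

end Smagorinsky

end

/-! ### Calculus in time: squares of primitives and the growth bound. -/

namespace Smagorinsky

/-! Test the momentum equation with `w`. Since `∇·w = 0` and `w` vanishes on the boundary,
convection and pressure do no work. The viscous term gives the total dissipation `D`, and the
correction gives `β² (∂ₜ(a w), a w)`, which is again a time derivative. So the modified energy `e =
½‖w‖² + ½β²‖a w‖²` satisfies `e' = P - D`, with `P = (f, w)`.

The point is that `D` controls the whole of `e`, including the part with `a w`. Put `Y = ∫ |∇w|³`;
then `D ≥ (Cs δ)² Y`. The Poincaré inequality in `L³` (`MemW0.poincare`) bounds `∫ |w|³` by a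
multiple of `Y`, and `|a w|²` is a multiple of `|∇w||w|² ≤ |∇w|³ + |w|³` (`norm_aCoef_smul_sq_le`).
Thus `e ≤ const + const · Y`, and by Young's inequality `P` costs only half of the lower bound for
`D`. This gives `e' ≤ K - α e`, so `e` is bounded (`le_max_of_growth_le`).

Dividing `e(T) - e(0) = ∫ (P - D)` by `T` gives the bounded averages and their asymptotic equality.
The integral of the model dissipation is a bounded difference of values of `½β²‖a w‖²` plus a
nonnegative term dominated by `∫ D`.

Two points need care. Time derivatives are given through primitives at almost every `x`, so the
energy balance is a one-dimensional fact integrated by Fubini (`integral_norm_sq_eq_of_primitive`).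
And `w` is not a test field: the spatial identities pass to the limit from test fields, using the
exponents `1/3 + 1/3 + 1/3 = 1` (`energy_identity`). -/

theorem sq_primitive_eq {g : ℝ → ℝ} {T : ℝ} (c : ℝ) (hg : IntervalIntegrable g volume 0 T) :
    (c + ∫ s in (0 : ℝ)..T, g s) ^ 2 =
      c ^ 2 + 2 * ∫ s in (0 : ℝ)..T, g s * (c + ∫ r in (0 : ℝ)..s, g r) := by
  have hac : AbsolutelyContinuousOnInterval (fun s => c + ∫ r in (0 : ℝ)..s, g r) 0 T := by
    have h1 := hg.absolutelyContinuousOnInterval_intervalIntegral (c := 0) (by simp)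
    have h2 : AbsolutelyContinuousOnInterval (fun _ : ℝ => c) 0 T :=
      LipschitzOnWith.absolutelyContinuousOnInterval (K := 0)
        ((LipschitzWith.const c).lipschitzOnWith)
    exact h2.add h1
  have key := hac.integral_deriv_mul_eq_sub hac
  have hd : ∫ x in (0 : ℝ)..T, (deriv (fun s => c + ∫ r in (0 : ℝ)..s, g r) x *
        (c + ∫ r in (0 : ℝ)..x, g r) + (c + ∫ r in (0 : ℝ)..x, g r) *
        deriv (fun s => c + ∫ r in (0 : ℝ)..s, g r) x) =
      ∫ s in (0 : ℝ)..T, 2 * (g s * (c + ∫ r in (0 : ℝ)..s, g r)) := by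
    apply intervalIntegral.integral_congr_ae
    filter_upwards [hg.ae_hasDerivAt_integral] with x hx hxT
    have := ((hx (uIoc_subset_uIcc hxT) 0 (by simp)).const_add c).deriv
    rw [this]; ring
  rw [hd, intervalIntegral.integral_const_mul] at key
  simp only [intervalIntegral.integral_same, add_zero] at key
  linarith [sq (c + ∫ s in (0 : ℝ)..T, g s), sq c]

variable {d : ℕ}

theorem intervalIntegral_apply {g : ℝ → Vec d} {a b : ℝ} (hg : IntervalIntegrable g volume a b)
    (i : Fin d) : (∫ s in a..b, g s) i = ∫ s in a..b, g s i :=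
  ((EuclideanSpace.proj (𝕜 := ℝ) i).intervalIntegral_comp_comm hg).symm

/-- Sum of the scalar identity over the coordinates. -/
theorem norm_sq_primitive_eq {g : ℝ → Vec d} {T : ℝ} (hT : 0 ≤ T) (c : Vec d)
    (hg : IntervalIntegrable g volume 0 T) :
    ‖c + ∫ s in (0 : ℝ)..T, g s‖ ^ 2 =
      ‖c‖ ^ 2 + 2 * ∫ s in (0 : ℝ)..T, inner ℝ (g s) (c + ∫ r in (0 : ℝ)..s, g r) := by
  have hgi : ∀ i, IntervalIntegrable (fun s => g s i) volume 0 T := fun i =>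
    ⟨(EuclideanSpace.proj (𝕜 := ℝ) i).integrable_comp hg.1,
      (EuclideanSpace.proj (𝕜 := ℝ) i).integrable_comp hg.2⟩
  have hsub : ∀ s ∈ uIcc 0 T, IntervalIntegrable g volume 0 s := fun s hs =>
    hg.mono_set (by rw [uIcc_of_le hT] at hs; rw [uIcc_of_le hT, uIcc_of_le hs.1]
                    exact Icc_subset_Icc_right hs.2)
  have hinner : ∀ s ∈ uIcc 0 T, inner ℝ (g s) (c + ∫ r in (0 : ℝ)..s, g r) =
      ∑ i, g s i * (c i + ∫ r in (0 : ℝ)..s, g r i) := by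
    intro s hs
    simp only [PiLp.inner_apply, PiLp.add_apply]
    refine Finset.sum_congr rfl fun i _ => ?_
    rw [intervalIntegral_apply (hsub s hs)]
    simp [mul_comm]
  rw [intervalIntegral.integral_congr hinner, intervalIntegral.integral_finsetSum]
  · rw [EuclideanSpace.norm_sq_eq, EuclideanSpace.norm_sq_eq, Finset.mul_sum,
      ← Finset.sum_add_distrib]
    refine Finset.sum_congr rfl fun i _ => ?_
    rw [PiLp.add_apply, intervalIntegral_apply hg, Real.norm_eq_abs, sq_abs, Real.norm_eq_abs,
      sq_abs, sq_primitive_eq _ (hgi i)]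
  · intro i _
    refine (hgi i).mul_continuousOn ?_
    exact continuousOn_const.add
      ((hgi i).absolutelyContinuousOnInterval_intervalIntegral (c := 0) (by simp)).continuousOn

variable {X Y : Type*} [MeasurableSpace X] [MeasurableSpace Y]

/-- The converse half of Fubini for null sets needs a measurable set, so it is applied to the zero
set of a strongly measurable representative of `u - v`. -/
theorem ae_prod_eq_of_ae_ae {F : Type*} [NormedAddCommGroup F] {τ : Measure Y} {μ : Measure X}
    [SFinite τ] [SFinite μ] {u v : Y × X → F} (hu : AEStronglyMeasurable u (τ.prod μ))
    (hv : AEStronglyMeasurable v (τ.prod μ))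
    (h : ∀ᵐ t ∂τ, ∀ᵐ x ∂μ, u (t, x) = v (t, x)) : u =ᵐ[τ.prod μ] v := by
  have h1 := (hu.sub hv)
  have hm : MeasurableSet {z | h1.mk _ z = 0} :=
    h1.stronglyMeasurable_mk.measurableSet_eq_fun stronglyMeasurable_const
  have h2 : ∀ᵐ z ∂τ.prod μ, h1.mk _ z = 0 := by
    rw [Measure.ae_prod_iff_ae_ae hm]
    filter_upwards [h, Measure.ae_ae_of_ae_prod h1.ae_eq_mk] with t ht1 ht2
    filter_upwards [ht1, ht2] with x hx1 hx2
    rw [← hx2]; simp [hx1]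
  filter_upwards [h1.ae_eq_mk, h2] with z hz1 hz2
  rw [hz2] at hz1
  exact sub_eq_zero.1 hz1

/-- The primitive is a partial integral of `1_{s ≤ t} g(s, x)`, which is jointly measurable in `((t,
x), s)`. -/
theorem aestronglyMeasurable_primitive {F : Type*} [NormedAddCommGroup F] [NormedSpace ℝ F]
    {μ : Measure X} [SFinite μ] {g : ℝ → X → F} {T : ℝ}
    (hg : AEStronglyMeasurable (fun z : ℝ × X => g z.1 z.2)
      ((volume.restrict (Ioo 0 T)).prod μ)) :
    AEStronglyMeasurable (fun z : ℝ × X => ∫ s in (0 : ℝ)..z.1, g s z.2)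
      ((volume.restrict (Ioo 0 T)).prod μ) := by
  set τ : Measure ℝ := volume.restrict (Ioo 0 T) with hτ
  have hq : Measure.QuasiMeasurePreserving (fun z : (ℝ × X) × ℝ => (z.2, z.1.2))
      ((τ.prod μ).prod τ) (τ.prod μ) := by
    have h1 : Measure.QuasiMeasurePreserving (Prod.map (Prod.snd : ℝ × X → X) (id : ℝ → ℝ))
        ((τ.prod μ).prod τ) (μ.prod τ) :=
      QuasiMeasurePreserving.prodMap Measure.quasiMeasurePreserving_snd
        (Measure.QuasiMeasurePreserving.id τ)
    exact (Measure.measurePreserving_swap.quasiMeasurePreserving).comp h1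
  have h2 : AEStronglyMeasurable
      ({z : (ℝ × X) × ℝ | z.2 ≤ z.1.1}.indicator fun z => g z.2 z.1.2) ((τ.prod μ).prod τ) := by
    refine (hg.comp_quasiMeasurePreserving hq).indicator ?_
    exact measurableSet_le (by fun_prop) (by fun_prop)
  refine h2.integral_prod_right'.congr ?_
  have h3 : ∀ᵐ z ∂(τ.prod μ), z.1 ∈ Ioo 0 T :=
    Measure.quasiMeasurePreserving_fst.ae (ae_restrict_mem measurableSet_Ioo)
  filter_upwards [h3] with z hz
  rw [intervalIntegral.integral_of_le hz.1.le]
  have : ∀ r, ({z : (ℝ × X) × ℝ | z.2 ≤ z.1.1}.indicator (fun z => g z.2 z.1.2)) (z, r) =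
      (Iic z.1).indicator (fun r => g r z.2) r := by
    intro r; simp [indicator]
  simp_rw [this]
  rw [integral_indicator measurableSet_Iic, hτ, Measure.restrict_restrict measurableSet_Iic]
  congr 2
  ext r
  simp only [mem_inter_iff, mem_Iic, mem_Ioo, mem_Ioc]
  constructor
  · rintro ⟨a, b, c⟩; exact ⟨b, a⟩
  · rintro ⟨a, b⟩; exact ⟨b, a, b.trans_lt hz.2⟩

/-- Exchanging the quantifiers to "a.e. `x`, a.e. `t`" permits the use of `norm_sq_primitive_eq` on
almost every time line; Fubini does the rest. The left side contains the primitive and not `u T`, so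
the identity holds at every `T > 0`. -/
theorem integral_norm_sq_eq_of_primitive {μ : Measure X} [IsFiniteMeasure μ]
    {u₀ : X → Vec d} {u g : ℝ → X → Vec d} {T : ℝ} (hT : 0 < T) (hu₀ : MemLp u₀ 2 μ)
    (hg : MemLp (fun z : ℝ × X => g z.1 z.2) 2 ((volume.restrict (Ioo 0 T)).prod μ))
    (hu : MemLp (fun z : ℝ × X => u z.1 z.2) 2 ((volume.restrict (Ioo 0 T)).prod μ))
    (h : ∀ᵐ t ∂(volume.restrict (Ioo 0 T)), ∀ᵐ x ∂μ,
      u t x = u₀ x + ∫ s in (0 : ℝ)..t, g s x) :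
    ∫ x, ‖u₀ x + ∫ s in (0 : ℝ)..T, g s x‖ ^ 2 ∂μ =
      ∫ x, ‖u₀ x‖ ^ 2 ∂μ + 2 * ∫ s in (0 : ℝ)..T, ∫ x, inner ℝ (g s x) (u s x) ∂μ := by
  set τ : Measure ℝ := volume.restrict (Ioo 0 T) with hτ
  have hU : AEStronglyMeasurable (fun z : ℝ × X => u₀ z.2 + ∫ s in (0 : ℝ)..z.1, g s z.2)
      (τ.prod μ) := hu₀.1.comp_snd.add (aestronglyMeasurable_primitive hg.1)
  have hae := ae_prod_eq_of_ae_ae hu.1 hU h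
  have hgu : Integrable (fun z : ℝ × X => inner ℝ (g z.1 z.2) (u z.1 z.2)) (τ.prod μ) :=
    memLp_one_iff_integrable.1 ((innerSL ℝ).memLp_of_bilin 1 hg hu)
  have hae' : ∀ᵐ x ∂μ, ∀ᵐ s ∂τ, u s x = u₀ x + ∫ r in (0 : ℝ)..s, g r x := by
    have := Measure.measurePreserving_swap (μ := μ) (ν := τ)
    exact Measure.ae_ae_of_ae_prod (this.quasiMeasurePreserving.ae hae)
  have hgi : ∀ᵐ x ∂μ, Integrable (fun s => g s x) τ :=
    (hg.integrable (by norm_num)).prod_left_ae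
  have hpt : ∀ᵐ x ∂μ, ‖u₀ x + ∫ s in (0 : ℝ)..T, g s x‖ ^ 2 =
      ‖u₀ x‖ ^ 2 + 2 * ∫ s, inner ℝ (g s x) (u s x) ∂τ := by
    filter_upwards [hae', hgi] with x hx1 hx2
    have hi : IntervalIntegrable (fun s => g s x) volume 0 T := by
      rw [intervalIntegrable_iff_integrableOn_Ioo_of_le hT.le]; exact hx2
    rw [norm_sq_primitive_eq hT.le _ hi, intervalIntegral.integral_of_le hT.le,
      integral_Ioc_eq_integral_Ioo]
    congr 2
    refine integral_congr_ae ?_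
    filter_upwards [hx1] with s hs
    rw [hs]
  rw [integral_congr_ae hpt, integral_add, integral_const_mul,
    intervalIntegral.integral_of_le hT.le, integral_Ioc_eq_integral_Ioo]
  · congr 2
    exact integral_integral_swap hgu.swap
  · exact hu₀.integrable_norm_pow (by norm_num)
  · exact (hgu.integral_prod_right).const_mul 2

/-- A function whose growth rate is at most `K - α e` stays below `max (e 0) (K / α)`. -/
theorem le_max_of_growth_le {e g : ℝ → ℝ} {K α : ℝ} (hα : 0 < α)
    (hg : ∀ T, 0 ≤ T → IntervalIntegrable g volume 0 T)
    (he : ∀ T, 0 ≤ T → e T = e 0 + ∫ s in (0 : ℝ)..T, g s)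
    (hle : ∀ᵐ t ∂(volume.restrict (Ioi (0 : ℝ))), g t ≤ K - α * e t) {T : ℝ} (hT : 0 ≤ T) :
    e T ≤ max (e 0) (K / α) := by
  by_contra! hcon
  set M := max (e 0) (K / α)
  have hcont : ContinuousOn e (Icc 0 T) := by
    have h1 := (hg T hT).absolutelyContinuousOnInterval_intervalIntegral (c := 0) (by simp)
    have h2 := h1.continuousOn
    rw [uIcc_of_le hT] at h2
    exact (continuousOn_const.add h2).congr fun t ht => he t ht.1
  set S := Icc 0 T ∩ e ⁻¹' Iic M
  have hSc : IsCompact S :=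
    isCompact_Icc.of_isClosed_subset (hcont.preimage_isClosed_of_isClosed isClosed_Icc isClosed_Iic)
      inter_subset_left
  have hS0 : (0 : ℝ) ∈ S := ⟨⟨le_rfl, hT⟩, le_max_left (e 0) (K / α)⟩
  -- Last time at which `e ≤ M`. Afterwards `e > M ≥ K / α` makes `g` nonpositive, so `e T ≤ e s ≤
  -- M`.
  obtain ⟨s, hs, hmax⟩ := hSc.exists_isGreatest ⟨0, hS0⟩
  have hsT : s ≤ T := hs.1.2
  have hs0 : 0 ≤ s := hs.1.1
  have hgt : ∀ t ∈ Ioc s T, M < e t := by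
    intro t ht
    by_contra! hle'
    exact absurd (hmax ⟨⟨hs0.trans ht.1.le, ht.2⟩, hle'⟩) (not_le.2 ht.1)
  have hdiff : e T - e s = ∫ t in s..T, g t := by
    rw [he T hT, he s hs0, ← intervalIntegral.integral_interval_sub_left (hg T hT) (hg s hs0)]
    ring
  have hneg : ∫ t in s..T, g t ≤ 0 := by
    rw [intervalIntegral.integral_of_le hsT]
    refine integral_nonpos_of_ae ?_
    have h0 : ∀ᵐ t ∂(volume.restrict (Ioc s T)), g t ≤ K - α * e t :=
      ae_mono (Measure.restrict_mono (fun t ht => lt_of_le_of_lt hs0 ht.1) le_rfl) hle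
    filter_upwards [h0, ae_restrict_mem measurableSet_Ioc] with t h1 h2
    have h3 := (le_max_right (e 0) (K / α)).trans_lt (hgt t h2)
    rw [div_lt_iff₀ hα] at h3
    simp only [Pi.zero_apply]
    linarith [mul_comm α (e t)]
  have : e s ≤ M := hs.2
  linarith

end Smagorinsky

/-! ### Hölder limits and integration by parts for test fields. -/

namespace Smagorinsky

section Holder

variable {X E F G : Type*} [MeasurableSpace X] [NormedAddCommGroup E] [NormedSpace ℝ E]
  [NormedAddCommGroup F] [NormedSpace ℝ F] [NormedAddCommGroup G] [NormedSpace ℝ G]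

/-- Split the difference as `B (uₙ - u) vₙ + B u (vₙ - v)` and use Hölder on each term; `‖vₙ‖ ≤ ‖vₙ
- v‖ + ‖v‖` stays under control. -/
theorem tendsto_eLpNorm_bilin (B : E →L[ℝ] F →L[ℝ] G) {μ : Measure X} {p q r : ℝ≥0∞}
    [ENNReal.HolderTriple p q r] (hq : 1 ≤ q) (hr : 1 ≤ r) {us : ℕ → X → E} {u : X → E}
    {vs : ℕ → X → F} {v : X → F} (hus : ∀ n, MemLp (us n) p μ) (hu : MemLp u p μ)
    (hvs : ∀ n, MemLp (vs n) q μ) (hv : MemLp v q μ)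
    (hul : Tendsto (fun n => eLpNorm (fun x => us n x - u x) p μ) atTop (𝓝 0))
    (hvl : Tendsto (fun n => eLpNorm (fun x => vs n x - v x) q μ) atTop (𝓝 0)) :
    Tendsto (fun n => eLpNorm (fun x => B (us n x) (vs n x) - B (u x) (v x)) r μ) atTop (𝓝 0) := by
  have hb : ∀ (a : X → E) (b : X → F), MemLp a p μ → MemLp b q μ →
      eLpNorm (fun x => B (a x) (b x)) r μ ≤ ‖B‖₊ * eLpNorm a p μ * eLpNorm b q μ :=
    fun a b ha hb => eLpNorm_le_eLpNorm_mul_eLpNorm_of_nnnorm ha.1 hb.1 (fun x y => B x y) ‖B‖₊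
      (.of_forall fun _ => B.le_opNorm₂ _ _)
  have hbound : ∀ n, eLpNorm (fun x => B (us n x) (vs n x) - B (u x) (v x)) r μ ≤
      ‖B‖₊ * eLpNorm (fun x => us n x - u x) p μ *
        (eLpNorm (fun x => vs n x - v x) q μ + eLpNorm v q μ) +
      ‖B‖₊ * eLpNorm u p μ * eLpNorm (fun x => vs n x - v x) q μ := by
    intro n
    have hdu : MemLp (fun x => us n x - u x) p μ := (hus n).sub hu
    have hdv : MemLp (fun x => vs n x - v x) q μ := (hvs n).sub hv
    have e1 : (fun x => B (us n x) (vs n x) - B (u x) (v x)) =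
        (fun x => B (us n x - u x) (vs n x)) + fun x => B (u x) (vs n x - v x) := by
      ext x; simp
    have e2 : eLpNorm (vs n) q μ ≤ eLpNorm (fun x => vs n x - v x) q μ + eLpNorm v q μ := by
      refine le_trans (le_of_eq ?_) (eLpNorm_add_le hdv.1 hv.1 hq)
      congr 1; ext x; simp
    rw [e1]
    refine (eLpNorm_add_le (B.memLp_of_bilin r hdu (hvs n)).1
      (B.memLp_of_bilin r hu hdv).1 hr).trans ?_
    gcongr
    · exact (hb _ _ hdu (hvs n)).trans (by gcongr)
    · exact hb _ _ hu hdv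
  refine tendsto_of_tendsto_of_tendsto_of_le_of_le tendsto_const_nhds ?_ (fun _ => zero_le) hbound
  have t1 := ENNReal.Tendsto.const_mul (a := (‖B‖₊ : ℝ≥0∞)) hul (Or.inr ENNReal.coe_ne_top)
  have t2 := hvl.add_const (eLpNorm v q μ)
  have t3 := ENNReal.Tendsto.mul t1 (Or.inr (by simpa using hv.2.ne)) t2 (Or.inr (by simp))
  have t4 := ENNReal.Tendsto.const_mul (a := (‖B‖₊ : ℝ≥0∞) * eLpNorm u p μ) hvl
    (Or.inr (ENNReal.mul_ne_top ENNReal.coe_ne_top hu.2.ne))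
  simpa using t3.add t4

theorem tendsto_integral_bilin [CompleteSpace G] (B : E →L[ℝ] F →L[ℝ] G) {μ : Measure X}
    {p q : ℝ≥0∞} [ENNReal.HolderTriple p q 1] (hq : 1 ≤ q) {us : ℕ → X → E} {u : X → E}
    {vs : ℕ → X → F} {v : X → F} (hus : ∀ n, MemLp (us n) p μ) (hu : MemLp u p μ)
    (hvs : ∀ n, MemLp (vs n) q μ) (hv : MemLp v q μ)
    (hul : Tendsto (fun n => eLpNorm (fun x => us n x - u x) p μ) atTop (𝓝 0))
    (hvl : Tendsto (fun n => eLpNorm (fun x => vs n x - v x) q μ) atTop (𝓝 0)) :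
    Tendsto (fun n => ∫ x, B (us n x) (vs n x) ∂μ) atTop (𝓝 (∫ x, B (u x) (v x) ∂μ)) :=
  tendsto_integral_of_L1' _ (B.memLp_of_bilin 1 hu hv).1
    (.of_forall fun n => memLp_one_iff_integrable.1 (B.memLp_of_bilin 1 (hus n) (hvs n)))
    (tendsto_eLpNorm_bilin B hq le_rfl hus hu hvs hv hul hvl)

theorem tendsto_integral_bilin_const_left [CompleteSpace G] (B : E →L[ℝ] F →L[ℝ] G)
    {μ : Measure X} {p q : ℝ≥0∞} [ENNReal.HolderTriple p q 1] (hq : 1 ≤ q) {u : X → E}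
    {vs : ℕ → X → F} {v : X → F} (hu : MemLp u p μ)
    (hvs : ∀ n, MemLp (vs n) q μ) (hv : MemLp v q μ)
    (hvl : Tendsto (fun n => eLpNorm (fun x => vs n x - v x) q μ) atTop (𝓝 0)) :
    Tendsto (fun n => ∫ x, B (u x) (vs n x) ∂μ) atTop (𝓝 (∫ x, B (u x) (v x) ∂μ)) :=
  tendsto_integral_bilin B hq (fun _ => hu) hu hvs hv (by simp) hvl

end Holder

/-- Products of two `L³` functions (stress, convection) lie in `L^{3/2}`, which pairs with `L³`:
these two triples carry all the cubic terms. -/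
instance holderTriple_three_three : ENNReal.HolderTriple 3 3 (3 / 2) where
  inv_add_inv_eq_inv := by
    rw [ENNReal.inv_div (by simp) (by simp), ← two_mul, div_eq_mul_inv]

instance holderConjugate_three_halves : ENNReal.HolderTriple (3 / 2) 3 1 where
  inv_add_inv_eq_inv := by
    rw [ENNReal.inv_div (by simp) (by simp), inv_one, ← one_div, ENNReal.div_add_div_same]
    norm_num
    exact ENNReal.div_self (by simp) (by simp)

theorem one_le_three_halves : (1 : ℝ≥0∞) ≤ 3 / 2 := by
  rw [ENNReal.le_div_iff_mul_le (by simp) (by simp)]; norm_num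

variable {d : ℕ}

/-- The convective term as a bilinear map. -/
noncomputable def convectionL : Vec d →L[ℝ] Tensor d →L[ℝ] Vec d :=
  ∑ i, (ContinuousLinearMap.lsmul ℝ ℝ).bilinearComp
    (EuclideanSpace.proj i : Vec d →L[ℝ] ℝ) (PiLp.proj 2 (fun _ : Fin d => Vec d) i)

theorem convectionL_apply (v : Vec d) (G : Tensor d) : convectionL v G = convection v G := by
  simp [convectionL, convection]

/-- The trace as a continuous linear map. -/
noncomputable def traceL : Tensor d →L[ℝ] ℝ :=
  ∑ i, (EuclideanSpace.proj i : Vec d →L[ℝ] ℝ).comp (PiLp.proj 2 (fun _ : Fin d => Vec d) i)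

theorem traceL_apply (G : Tensor d) : traceL G = trace G := by
  simp [traceL, trace]

section TestField

variable {Ω : Set (Vec d)} {φ : Vec d → Vec d}

theorem IsTestField.continuous_grad (h : IsTestField Ω φ) : Continuous (grad φ) := by
  have h1 := h.1.continuous_fderiv (by simp)
  refine (PiLp.continuous_toLp 2 _).comp (continuous_pi fun i => ?_)
  exact h1.clm_apply continuous_const

theorem grad_eq_zero_of_notMem {x : Vec d} (hx : x ∉ tsupport φ) : grad φ x = 0 := by
  have : fderiv ℝ φ x = 0 := by
    by_contra hne
    exact hx (support_fderiv_subset ℝ (by simpa using hne))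
  ext i j
  simp [grad, this]

theorem IsTestField.hasCompactSupport_grad (h : IsTestField Ω φ) : HasCompactSupport (grad φ) :=
  HasCompactSupport.intro h.2.1.isCompact fun _ hx => grad_eq_zero_of_notMem hx

theorem IsTestField.memLp (h : IsTestField Ω φ) (p : ℝ≥0∞) : MemLp φ p (volume.restrict Ω) :=
  (h.1.continuous.memLp_of_hasCompactSupport h.2.1).restrict Ω

theorem IsTestField.memLp_grad (h : IsTestField Ω φ) (p : ℝ≥0∞) :
    MemLp (grad φ) p (volume.restrict Ω) :=
  (h.continuous_grad.memLp_of_hasCompactSupport h.hasCompactSupport_grad).restrict Ω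

theorem IsTestField.eq_zero (h : IsTestField Ω φ) {x : Vec d} (hx : x ∉ Ω) : φ x = 0 :=
  image_eq_zero_of_notMem_tsupport fun hx' => hx (h.2.2 hx')

theorem IsTestField.grad_eq_zero (h : IsTestField Ω φ) {x : Vec d} (hx : x ∉ Ω) :
    grad φ x = 0 :=
  grad_eq_zero_of_notMem fun hx' => hx (h.2.2 hx')

theorem fderiv_apply_coord (hφ : Differentiable ℝ φ) (x v : Vec d) (i : Fin d) :
    fderiv ℝ (fun y => φ y i) x v = fderiv ℝ φ x v i := by
  have := ((EuclideanSpace.proj (𝕜 := ℝ) i : Vec d →L[ℝ] ℝ).hasFDerivAt.comp x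
    (hφ x).hasFDerivAt).fderiv
  have h2 : (fun y => φ y i) = (EuclideanSpace.proj (𝕜 := ℝ) i : Vec d →L[ℝ] ℝ) ∘ φ := rfl
  rw [h2, this]; rfl

/-- Because `(φ·∇φ)·φ = ½ φ·∇|φ|²`, an integration by parts moves the derivative to the first
factor. The approximating fields need not be divergence free, so the trace term is kept. -/
theorem IsTestField.integral_convection (h : IsTestField Ω φ) :
    ∫ x in Ω, inner ℝ (convection (φ x) (grad φ x)) (φ x) =
      -(1 / 2) * ∫ x in Ω, inner ℝ (φ x) (φ x) * trace (grad φ x) := by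
  have hdiff : Differentiable ℝ φ := h.1.differentiable (by simp)
  have hc := h.1.continuous
  have hfc : Continuous (fderiv ℝ φ) := h.1.continuous_fderiv (by simp)
  have hderiv : ∀ x v, fderiv ℝ (fun y => inner ℝ (φ y) (φ y)) x v =
      2 * inner ℝ (fderiv ℝ φ x v) (φ x) := by
    intro x v
    rw [fderiv_inner_apply ℝ (hdiff x) (hdiff x), real_inner_comm]; ring
  have hcs : ∀ g : Vec d → ℝ, (∀ x, φ x = 0 → g x = 0) → HasCompactSupport g := fun g hg =>
    HasCompactSupport.intro h.2.1.isCompact fun x hx => hg x (image_eq_zero_of_notMem_tsupport hx)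
  have hi1 : ∀ i : Fin d, Integrable (fun x => φ x i *
      (2 * inner ℝ (fderiv ℝ φ x (EuclideanSpace.single i 1)) (φ x))) volume := fun i =>
    Continuous.integrable_of_hasCompactSupport (by fun_prop) (hcs _ fun x hx => by simp [hx])
  have hi2 : ∀ i : Fin d, Integrable (fun x =>
      fderiv ℝ φ x (EuclideanSpace.single i 1) i * inner ℝ (φ x) (φ x)) volume := fun i =>
    Continuous.integrable_of_hasCompactSupport (by fun_prop) (hcs _ fun x hx => by simp [hx])
  have hparts : ∀ i : Fin d, ∫ x, φ x i *
      (2 * inner ℝ (fderiv ℝ φ x (EuclideanSpace.single i 1)) (φ x)) =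
      -∫ x, fderiv ℝ φ x (EuclideanSpace.single i 1) i * inner ℝ (φ x) (φ x) := by
    intro i
    have := integral_mul_fderiv_eq_neg_fderiv_mul_of_integrable (μ := (volume : Measure (Vec d)))
      (f := fun y => φ y i) (g := fun y => inner ℝ (φ y) (φ y)) (v := EuclideanSpace.single i 1)
      (by simpa only [fderiv_apply_coord hdiff] using hi2 i)
      (by simpa only [hderiv] using hi1 i)
      (Continuous.integrable_of_hasCompactSupport (by fun_prop) (hcs _ fun x hx => by simp [hx]))
      (fun x _ => by fun_prop) (fun x _ => (hdiff.inner ℝ hdiff) x)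
    simpa only [fderiv_apply_coord hdiff, hderiv] using this
  -- The fields vanish off `Ω`, so the integrals extend to the whole space and no boundary term
  -- occurs.
  rw [setIntegral_eq_integral_of_forall_compl_eq_zero (fun x hx => by simp [h.eq_zero hx]),
    setIntegral_eq_integral_of_forall_compl_eq_zero (fun x hx => by simp [h.eq_zero hx])]
  have e1 : ∀ x, inner ℝ (convection (φ x) (grad φ x)) (φ x) = (1 / 2) * ∑ i, φ x i *
      (2 * inner ℝ (fderiv ℝ φ x (EuclideanSpace.single i 1)) (φ x)) := by
    intro x
    rw [convection, sum_inner, Finset.mul_sum]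
    refine Finset.sum_congr rfl fun i _ => ?_
    rw [real_inner_smul_left, grad]
    ring
  have e2 : ∀ x, inner ℝ (φ x) (φ x) * trace (grad φ x) =
      ∑ i, fderiv ℝ φ x (EuclideanSpace.single i 1) i * inner ℝ (φ x) (φ x) := by
    intro x
    rw [trace, Finset.mul_sum]
    exact Finset.sum_congr rfl fun i _ => mul_comm _ _
  simp_rw [e1, e2]
  rw [integral_const_mul, integral_finsetSum _ fun i _ => hi1 i,
    integral_finsetSum _ fun i _ => hi2 i, Finset.sum_congr rfl fun i _ => hparts i,
    Finset.sum_neg_distrib]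
  ring

/-- Young's inequality by cases: if `6Rb ≤ a`, the left side is at most `a³/2`; otherwise `a² ≤
36R²b²`, and `3 · 36 = 108`. -/
theorem mul_sq_mul_le {R a b : ℝ} (hR : 0 ≤ R) (ha : 0 ≤ a) (hb : 0 ≤ b) :
    3 * R * a ^ 2 * b ≤ a ^ 3 / 2 + 108 * R ^ 3 * b ^ 3 := by
  rcases le_total (6 * R * b) a with h | h
  · have : 0 ≤ 108 * R ^ 3 * b ^ 3 := by positivity
    nlinarith [mul_le_mul_of_nonneg_left h (sq_nonneg a)]
  · have h1 : a ^ 2 ≤ (6 * R * b) ^ 2 := by gcongr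
    have h2 : 0 ≤ 3 * R * b := by positivity
    have h3 : 0 ≤ a ^ 3 := by positivity
    nlinarith [mul_le_mul_of_nonneg_right h1 h2]

/-- Write `1 = ∂ᵢxᵢ` for one coordinate and integrate by parts against `|φ|³`. On `Ω` one has `|xᵢ|
≤ R`, and `mul_sq_mul_le` absorbs half of `∫ |φ|³`, so the constant is `2 · 108`. -/
theorem IsTestField.poincare (h : IsTestField Ω φ) {R : ℝ} (hR : 0 ≤ R)
    (hΩ : Ω ⊆ Metric.closedBall 0 R) :
    ∫ x in Ω, ‖φ x‖ ^ 3 ≤ 216 * R ^ 3 * ∫ x in Ω, ‖grad φ x‖ ^ 3 := by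
  have hint : ∀ {F : Type} [NormedAddCommGroup F] (g : Vec d → F), Continuous g →
      HasCompactSupport g → Integrable (fun x => ‖g x‖ ^ 3) volume := fun g hg hg' =>
    Continuous.integrable_of_hasCompactSupport (by fun_prop)
      (hg'.norm.comp_left (g := fun y : ℝ => y ^ 3) (by simp))
  -- In dimension zero there is no coordinate to integrate along, but then `φ = 0`.
  rcases Nat.eq_zero_or_pos d with hd | hd
  · subst hd
    have : ∀ x, φ x = 0 := fun x => Subsingleton.elim _ _
    simp only [this, norm_zero, ne_eq, OfNat.ofNat_ne_zero, not_false_eq_true, zero_pow,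
      integral_zero]
    positivity
  set i : Fin d := ⟨0, hd⟩
  set v : Vec d := EuclideanSpace.single i 1 with hv
  have hdiff : Differentiable ℝ φ := h.1.differentiable (by simp)
  have hc := h.1.continuous
  have hfc : Continuous (fderiv ℝ φ) := h.1.continuous_fderiv (by simp)
  -- The real power is `C¹` also at the zeros of `φ`, since `3 > 1`.
  have hg1 : ContDiff ℝ 1 (fun x => ‖φ x‖ ^ (3 : ℝ)) :=
    (h.1.of_le (by exact_mod_cast le_top)).norm_rpow (by norm_num)
  have hderiv : ∀ x, fderiv ℝ (fun x => ‖φ x‖ ^ (3 : ℝ)) x v =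
      3 * ‖φ x‖ * inner ℝ (φ x) (fderiv ℝ φ x v) := by
    intro x
    rw [hdiff.fderiv_norm_rpow (by norm_num)]
    norm_num
  have hcs : ∀ g : Vec d → ℝ, (∀ x, φ x = 0 → g x = 0) → HasCompactSupport g := fun g hg =>
    HasCompactSupport.intro h.2.1.isCompact fun x hx => hg x (image_eq_zero_of_notMem_tsupport hx)
  have hcoord : ∀ x : Vec d, fderiv ℝ (fun y : Vec d => y i) x v = 1 := by
    intro x
    have : fderiv ℝ (fun y : Vec d => y i) x = (EuclideanSpace.proj i : Vec d →L[ℝ] ℝ) :=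
      (EuclideanSpace.proj i : Vec d →L[ℝ] ℝ).hasFDerivAt.fderiv
    rw [this]; simp [hv]
  have hi1 : Integrable (fun x => x i * (3 * ‖φ x‖ * inner ℝ (φ x) (fderiv ℝ φ x v))) volume :=
    Continuous.integrable_of_hasCompactSupport (by fun_prop) (hcs _ fun x hx => by simp [hx])
  have hi0 := hint φ hc h.2.1
  have hparts := integral_mul_fderiv_eq_neg_fderiv_mul_of_integrable
    (μ := (volume : Measure (Vec d))) (f := fun y => y i) (g := fun y => ‖φ y‖ ^ (3 : ℝ)) (v := v)
    (by simp only [hcoord, one_mul]; exact_mod_cast hi0)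
    (by simpa only [hderiv] using hi1)
    (Continuous.integrable_of_hasCompactSupport
      (Continuous.mul (by fun_prop) hg1.continuous) (hcs _ fun x hx => by simp [hx]))
    (fun x _ => by fun_prop) (fun x _ => hg1.differentiable (by simp) x)
  simp only [hcoord, hderiv, one_mul] at hparts
  have hi2 := hint _ h.continuous_grad h.hasCompactSupport_grad
  have hpt : ∀ x, -(x i * (3 * ‖φ x‖ * inner ℝ (φ x) (fderiv ℝ φ x v))) ≤
      ‖φ x‖ ^ 3 / 2 + 108 * R ^ 3 * ‖grad φ x‖ ^ 3 := by
    intro x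
    by_cases hx : x ∈ Ω
    · have h1 : |x i| ≤ R := by
        refine le_trans ?_ (mem_closedBall_zero_iff.1 (hΩ hx))
        exact PiLp.norm_apply_le x i
      have h2 : ‖fderiv ℝ φ x v‖ ≤ ‖grad φ x‖ := PiLp.norm_apply_le (grad φ x) i
      have h3 := abs_real_inner_le_norm (φ x) (fderiv ℝ φ x v)
      refine le_trans ?_ (mul_sq_mul_le hR (norm_nonneg (φ x)) (norm_nonneg (grad φ x)))
      refine (neg_le_abs _).trans ?_
      rw [abs_mul, abs_mul, abs_of_nonneg (by positivity : 0 ≤ 3 * ‖φ x‖)]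
      calc |x i| * (3 * ‖φ x‖ * |inner ℝ (φ x) (fderiv ℝ φ x v)|)
          ≤ R * (3 * ‖φ x‖ * (‖φ x‖ * ‖grad φ x‖)) := by
            gcongr
            exact h3.trans (by gcongr)
        _ = _ := by ring
    · simp only [h.eq_zero hx, norm_zero, mul_zero, zero_mul, neg_zero]
      positivity
  rw [setIntegral_eq_integral_of_forall_compl_eq_zero (fun x hx => by simp [h.eq_zero hx]),
    setIntegral_eq_integral_of_forall_compl_eq_zero (fun x hx => by simp [h.grad_eq_zero hx])]
  have hmono := integral_mono hi1.neg ((hi0.div_const 2).add (hi2.const_mul (108 * R ^ 3)))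
    (fun x => hpt x)
  simp only [Pi.neg_apply, Pi.add_apply] at hmono
  rw [integral_neg, integral_add (hi0.div_const 2) (hi2.const_mul _), integral_div,
    integral_const_mul] at hmono
  have e : ∫ x, ‖φ x‖ ^ (3 : ℝ) = ∫ x, ‖φ x‖ ^ 3 := by
    refine integral_congr_ae (.of_forall fun x => ?_)
    exact_mod_cast Real.rpow_natCast _ 3
  rw [e] at hparts
  linarith

end TestField

end Smagorinsky

/-! ### Spatial identities in `W₀^{1,3}` and the energy identity at a fixed time. -/

namespace Smagorinsky

variable {d : ℕ}

/-- The real inner product as a bilinear map. -/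
noncomputable def innerL {F : Type*} [NormedAddCommGroup F] [InnerProductSpace ℝ F] :
    F →L[ℝ] F →L[ℝ] ℝ := innerSL ℝ

theorem innerL_apply {F : Type*} [NormedAddCommGroup F] [InnerProductSpace ℝ F] (u v : F) :
    innerL u v = inner ℝ u v := rfl

section W0

variable {Ω : Set (Vec d)} {u : Vec d → Vec d} {G : Vec d → Tensor d}

theorem ofReal_integral_norm_pow {X F : Type*} [MeasurableSpace X] [NormedAddCommGroup F]
    {μ : Measure X} {u : X → F} {n : ℕ} (hn : n ≠ 0) (hu : MemLp u n μ) :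
    ENNReal.ofReal (∫ x, ‖u x‖ ^ n ∂μ) = eLpNorm u n μ ^ n := by
  have hpos : 0 ≤ ∫ x, ‖u x‖ ^ n ∂μ := by positivity
  rw [hu.eLpNorm_eq_integral_rpow_norm (by simpa using hn) (by simp),
    ← ENNReal.ofReal_pow (by positivity)]
  congr 1
  have : ∫ x, ‖u x‖ ^ (ENNReal.toReal n) ∂μ = ∫ x, ‖u x‖ ^ n ∂μ := by simp
  rw [this, ← Real.rpow_natCast, ← Real.rpow_mul hpos]
  simp [hn]

theorem ofReal_integral_norm_cube {X F : Type*} [MeasurableSpace X] [NormedAddCommGroup F]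
    {μ : Measure X} {u : X → F} (hu : MemLp u 3 μ) :
    ENNReal.ofReal (∫ x, ‖u x‖ ^ 3 ∂μ) = eLpNorm u 3 μ ^ 3 := by
  exact_mod_cast ofReal_integral_norm_pow (n := 3) (by norm_num) (by exact_mod_cast hu)

/-- The limit is taken in the form `‖φ‖₃ ≤ 6R ‖∇φ‖₃`, where `(6R)³ = 216R³`, because this form is
stable under `L³` convergence. -/
theorem MemW0.poincare (h : MemW0 Ω 3 u G) {R : ℝ} (hR : 0 ≤ R)
    (hΩ : Ω ⊆ Metric.closedBall 0 R) :
    ∫ x in Ω, ‖u x‖ ^ 3 ≤ 216 * R ^ 3 * ∫ x in Ω, ‖G x‖ ^ 3 := by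
  obtain ⟨hu, hG, φ, hφ, hφu, hφG⟩ := h
  set μ := volume.restrict Ω
  have h0 : ∀ n, eLpNorm (φ n) 3 μ ≤ ENNReal.ofReal (6 * R) * eLpNorm (grad (φ n)) 3 μ := by
    intro n
    have h1 := ENNReal.ofReal_le_ofReal ((hφ n).poincare hR hΩ)
    rw [ENNReal.ofReal_mul (by positivity), ofReal_integral_norm_cube ((hφ n).memLp 3),
      ofReal_integral_norm_cube ((hφ n).memLp_grad 3),
      show 216 * R ^ 3 = (6 * R) ^ 3 by ring, ENNReal.ofReal_pow (by positivity), ← mul_pow] at h1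
    exact (ENNReal.pow_le_pow_left_iff (by norm_num)).1 h1
  have h1 : ∀ n, eLpNorm u 3 μ ≤ eLpNorm (fun x => φ n x - u x) 3 μ +
      ENNReal.ofReal (6 * R) * (eLpNorm (fun x => grad (φ n) x - G x) 3 μ + eLpNorm G 3 μ) := by
    intro n
    have e1 : eLpNorm u 3 μ ≤ eLpNorm (fun x => φ n x - u x) 3 μ + eLpNorm (φ n) 3 μ := by
      rw [← eLpNorm_neg (fun x => φ n x - u x)]
      refine le_trans (le_of_eq ?_)
        (eLpNorm_add_le (((hφ n).memLp 3).sub hu).1.neg ((hφ n).memLp 3).1 (by norm_num))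
      congr 1; ext x; simp
    have e2 : eLpNorm (grad (φ n)) 3 μ ≤
        eLpNorm (fun x => grad (φ n) x - G x) 3 μ + eLpNorm G 3 μ := by
      refine le_trans (le_of_eq ?_)
        (eLpNorm_add_le (((hφ n).memLp_grad 3).sub hG).1 hG.1 (by norm_num))
      congr 1; ext x; simp
    exact e1.trans (by gcongr; exact (h0 n).trans (by gcongr))
  have h2 : eLpNorm u 3 μ ≤ ENNReal.ofReal (6 * R) * eLpNorm G 3 μ := by
    have t := hφu.add (ENNReal.Tendsto.const_mul (a := ENNReal.ofReal (6 * R))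
      (hφG.add_const (eLpNorm G 3 μ)) (Or.inr ENNReal.ofReal_ne_top))
    simp only [zero_add] at t
    exact ge_of_tendsto' t h1
  have h3 := ENNReal.pow_le_pow_left h2 (n := 3)
  rw [mul_pow, ← ENNReal.ofReal_pow (by positivity), ← ofReal_integral_norm_cube hu,
    ← ofReal_integral_norm_cube hG, ← ENNReal.ofReal_mul (by positivity),
    ENNReal.ofReal_le_ofReal_iff (by positivity)] at h3
  linarith [show (6 * R) ^ 3 = 216 * R ^ 3 by ring]

/-- In the limit of the approximating test fields `∫ ∇p·u = -∫ p ∇·u`; only the limit has to be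
divergence free. -/
theorem MemW0.integral_inner_grad_pressure_eq_zero (h : MemW0 Ω 3 u G)
    (hdiv : ∀ᵐ x ∂volume.restrict Ω, trace (G x) = 0) {p : Vec d → ℝ} {Dp : Vec d → Vec d}
    (hp : MemLp p (3 / 2) (volume.restrict Ω)) (hDp : MemLp Dp (3 / 2) (volume.restrict Ω))
    (hw : IsWeakGrad Ω p Dp) : ∫ x in Ω, inner ℝ (Dp x) (u x) = 0 := by
  obtain ⟨hu, hG, φ, hφ, hφu, hφG⟩ := h
  have t1 := tendsto_integral_bilin_const_left
    ((ContinuousLinearMap.lsmul ℝ ℝ).bilinearComp (ContinuousLinearMap.id ℝ ℝ) traceL)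
    (by norm_num) hp (fun n => (hφ n).memLp_grad 3) hG hφG
  have t2 := tendsto_integral_bilin_const_left innerL (by norm_num) hDp
    (fun n => (hφ n).memLp 3) hu hφu
  have e : ∀ n, ∫ x in Ω, innerL (Dp x) (φ n x) =
      -∫ x in Ω, ((ContinuousLinearMap.lsmul ℝ ℝ).bilinearComp (ContinuousLinearMap.id ℝ ℝ) traceL)
        (p x) (grad (φ n) x) := by
    intro n
    simp only [innerL_apply, ContinuousLinearMap.bilinearComp_apply, traceL_apply,
      ContinuousLinearMap.lsmul_apply, ContinuousLinearMap.id_apply, smul_eq_mul]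
    rw [hw _ (hφ n), neg_neg]
  simp_rw [e] at t2
  have h1 := tendsto_nhds_unique t2 t1.neg
  simp only [innerL_apply, ContinuousLinearMap.bilinearComp_apply, traceL_apply,
    ContinuousLinearMap.lsmul_apply, ContinuousLinearMap.id_apply, smul_eq_mul] at h1
  rw [h1, integral_eq_zero_of_ae, neg_zero]
  filter_upwards [hdiv] with x hx
  simp [hx]

/-- Both sides are continuous in the test field for the `W^{1,3}` norm, since `S` and `k` are in the
dual space `L^{3/2}`; so `u` itself is admissible. -/
theorem MemW0.integral_inner_weakDiv (h : MemW0 Ω 3 u G) {S : Vec d → Tensor d}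
    {k : Vec d → Vec d} (hS : MemLp S (3 / 2) (volume.restrict Ω))
    (hk : MemLp k (3 / 2) (volume.restrict Ω)) (hw : IsWeakDiv Ω S k) :
    ∫ x in Ω, inner ℝ (S x) (G x) = -∫ x in Ω, inner ℝ (k x) (u x) := by
  obtain ⟨hu, hG, φ, hφ, hφu, hφG⟩ := h
  have t1 := tendsto_integral_bilin_const_left innerL (by norm_num) hS
    (fun n => (hφ n).memLp_grad 3) hG hφG
  have t2 := tendsto_integral_bilin_const_left innerL (by norm_num) hk
    (fun n => (hφ n).memLp 3) hu hφu
  simp only [innerL_apply] at t1 t2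
  simp_rw [fun n => hw _ (hφ n)] at t1
  exact tendsto_nhds_unique t1 t2.neg

/-- The trilinear form is continuous on `L³ × L³ × L³`: Hölder is used first from `(3, 3)` to `3/2`,
then from `(3/2, 3)` to `1`. -/
theorem MemW0.integral_convection_eq_zero (h : MemW0 Ω 3 u G)
    (hdiv : ∀ᵐ x ∂volume.restrict Ω, trace (G x) = 0) :
    ∫ x in Ω, inner ℝ (convection (u x) (G x)) (u x) = 0 := by
  obtain ⟨hu, hG, φ, hφ, hφu, hφG⟩ := h
  have hφm := fun n => (hφ n).memLp (3 : ℝ≥0∞)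
  have hgm := fun n => (hφ n).memLp_grad (3 : ℝ≥0∞)
  have c1 := tendsto_eLpNorm_bilin convectionL (r := 3 / 2) (by norm_num) one_le_three_halves
    hφm hu hgm hG hφu hφG
  have t1 := tendsto_integral_bilin innerL (p := 3 / 2) (q := 3) (by norm_num)
    (fun n => convectionL.memLp_of_bilin (3 / 2) (hφm n) (hgm n))
    (convectionL.memLp_of_bilin (3 / 2) hu hG) hφm hu c1 hφu
  have c2 := tendsto_eLpNorm_bilin innerL (r := 3 / 2) (by norm_num) one_le_three_halves
    hφm hu hφm hu hφu hφu
  have t2 := tendsto_integral_bilin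
    ((ContinuousLinearMap.lsmul ℝ ℝ).bilinearComp (ContinuousLinearMap.id ℝ ℝ) traceL)
    (p := 3 / 2) (q := 3) (by norm_num)
    (fun n => innerL.memLp_of_bilin (3 / 2) (hφm n) (hφm n))
    (innerL.memLp_of_bilin (3 / 2) hu hu) hgm hG c2 hφG
  simp only [innerL_apply, convectionL_apply, ContinuousLinearMap.bilinearComp_apply,
    traceL_apply, ContinuousLinearMap.lsmul_apply, ContinuousLinearMap.id_apply,
    smul_eq_mul] at t1 t2
  simp_rw [fun n => (hφ n).integral_convection] at t1
  rw [tendsto_nhds_unique t1 (t2.const_mul _), integral_eq_zero_of_ae, mul_zero]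
  filter_upwards [hdiv] with x hx
  simp [hx]

end W0

section Densities

variable {ν Cs δ β : ℝ}

theorem aCoef_sq (hν : 0 < ν) (G : Tensor d) :
    aCoef ν Cs δ G ^ 2 = ν⁻¹ * (Cs * δ) ^ 2 * ‖G‖ := by
  rw [aCoef, Real.sq_sqrt (by unfold nuT; positivity), nuT]; ring

/-- Here `a²` is a multiple of `‖G‖`, and `‖G‖‖v‖²` is at most the cube of the larger norm. This is
how the dissipation controls the correction energy. -/
theorem norm_aCoef_smul_sq_le (hν : 0 < ν) (G : Tensor d) (v : Vec d) :
    ‖aCoef ν Cs δ G • v‖ ^ 2 ≤ ν⁻¹ * (Cs * δ) ^ 2 * (‖G‖ ^ 3 + ‖v‖ ^ 3) := by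
  rw [norm_smul, mul_pow, Real.norm_eq_abs, sq_abs, aCoef_sq hν, mul_assoc]
  refine mul_le_mul_of_nonneg_left ?_ (by positivity)
  have h1 := norm_nonneg G
  have h2 := norm_nonneg v
  rcases le_total ‖G‖ ‖v‖ with h | h
  · nlinarith [mul_le_mul_of_nonneg_right h (sq_nonneg ‖v‖), pow_nonneg h1 3]
  · have : ‖v‖ ^ 2 ≤ ‖G‖ ^ 2 := by gcongr
    nlinarith [mul_le_mul_of_nonneg_left this h1, pow_nonneg h2 3]

theorem sq_le_one_add_cube {a : ℝ} (ha : 0 ≤ a) : a ^ 2 ≤ 1 + a ^ 3 := by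
  rcases le_total a 1 with h | h
  · nlinarith [pow_nonneg ha 3]
  · nlinarith [mul_le_mul_of_nonneg_right h (sq_nonneg a)]

theorem dissDensity_eq (G : Tensor d) :
    dissDensity ν Cs δ G = ν * ‖G‖ ^ 2 + (Cs * δ) ^ 2 * ‖G‖ ^ 3 := by
  rw [dissDensity, nuT, real_inner_self_eq_norm_sq]; ring

theorem dissDensity_le (hν : 0 < ν) (G : Tensor d) :
    dissDensity ν Cs δ G ≤ ν + (ν + (Cs * δ) ^ 2) * ‖G‖ ^ 3 := by
  rw [dissDensity_eq]
  nlinarith [mul_le_mul_of_nonneg_left (sq_le_one_add_cube (norm_nonneg G)) hν.le]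

/-- The factor `a` moves onto `v`, so that `∂ₜ(a w)` is paired with `a w` itself. -/
theorem mdDensity_eq (G : Tensor d) (v A : Vec d) : mdDensity ν Cs δ β G v A =
    β ^ 2 * inner ℝ A (aCoef ν Cs δ G • v) + (Cs * δ) ^ 2 * ‖G‖ ^ 3 := by
  rw [mdDensity, nuT, real_inner_smul_right]; ring

variable {X : Type*} [MeasurableSpace X] {μ : Measure X} {G : X → Tensor d} {v : X → Vec d}

theorem continuous_aCoef : Continuous (aCoef ν Cs δ : Tensor d → ℝ) := by
  unfold aCoef nuT; fun_prop

theorem memLp_aCoef_smul (hν : 0 < ν) (hG : MemLp G 3 μ) (hv : MemLp v 3 μ) :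
    MemLp (fun x => aCoef ν Cs δ (G x) • v x) 2 μ := by
  have hm : AEStronglyMeasurable (fun x => aCoef ν Cs δ (G x) • v x) μ :=
    (continuous_aCoef.comp_aestronglyMeasurable hG.1).smul hv.1
  rw [memLp_two_iff_integrable_sq_norm hm]
  refine (((hG.integrable_norm_pow (by norm_num)).add
    (hv.integrable_norm_pow (by norm_num))).const_mul (ν⁻¹ * (Cs * δ) ^ 2)).mono'
    (hm.norm.pow 2) (.of_forall fun x => ?_)
  rw [Real.norm_of_nonneg (by positivity)]
  exact norm_aCoef_smul_sq_le hν _ _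

theorem integrable_dissDensity [IsFiniteMeasure μ] (hG : MemLp G 3 μ) :
    Integrable (fun x => dissDensity ν Cs δ (G x)) μ := by
  simp_rw [dissDensity_eq]
  exact (((hG.mono_exponent (by norm_num : (2 : ℝ≥0∞) ≤ 3)).integrable_norm_pow
    (by norm_num)).const_mul _).add ((hG.integrable_norm_pow (by norm_num)).const_mul _)

theorem integrable_inner_of_memLp_two {F : Type*} [NormedAddCommGroup F] [InnerProductSpace ℝ F]
    {u v : X → F} (hu : MemLp u 2 μ) (hv : MemLp v 2 μ) :
    Integrable (fun x => inner ℝ (u x) (v x)) μ :=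
  memLp_one_iff_integrable.1 (innerL.memLp_of_bilin 1 hu hv)

theorem integrable_inner_of_memLp_three {F : Type*} [NormedAddCommGroup F] [InnerProductSpace ℝ F]
    {u v : X → F} (hu : MemLp u (3 / 2) μ) (hv : MemLp v 3 μ) :
    Integrable (fun x => inner ℝ (u x) (v x)) μ :=
  memLp_one_iff_integrable.1 (innerL.memLp_of_bilin 1 hu hv)

theorem integrable_mdDensity (hν : 0 < ν) (hG : MemLp G 3 μ) (hv : MemLp v 3 μ) {A : X → Vec d}
    (hA : MemLp A 2 μ) : Integrable (fun x => mdDensity ν Cs δ β (G x) (v x) (A x)) μ := by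
  simp_rw [mdDensity_eq]
  exact ((integrable_inner_of_memLp_two hA (memLp_aCoef_smul hν hG hv)).const_mul _).add
    ((hG.integrable_norm_pow (by norm_num)).const_mul _)

end Densities

/-- The energy identity at a fixed time: the momentum equation tested with the velocity. -/
theorem energy_identity {Ω : Set (Vec d)} [IsFiniteMeasure (volume.restrict Ω)] {ν Cs δ β : ℝ}
    (hν : 0 < ν) {w f wt A Dp k : Vec d → Vec d} {G : Vec d → Tensor d} {p : Vec d → ℝ}
    (h : MemW0 Ω 3 w G) (hdiv : ∀ᵐ x ∂volume.restrict Ω, trace (G x) = 0)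
    (hwt : MemLp wt 2 (volume.restrict Ω)) (hA : MemLp A 2 (volume.restrict Ω))
    (hp : MemLp p (3 / 2) (volume.restrict Ω)) (hDp : MemLp Dp (3 / 2) (volume.restrict Ω))
    (hk : MemLp k (3 / 2) (volume.restrict Ω)) (hgrad : IsWeakGrad Ω p Dp)
    (hvisc : IsWeakDiv Ω (fun x => (ν + nuT Cs δ (G x)) • G x) k)
    (heq : ∀ᵐ x ∂volume.restrict Ω,
      wt x + (β ^ 2 * aCoef ν Cs δ (G x)) • A x + convection (w x) (G x) + Dp x - k x = f x) :
    (∫ x in Ω, inner ℝ (wt x) (w x)) +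
      β ^ 2 * (∫ x in Ω, inner ℝ (A x) (aCoef ν Cs δ (G x) • w x)) +
      ∫ x in Ω, dissDensity ν Cs δ (G x) = ∫ x in Ω, inner ℝ (f x) (w x) := by
  have hw := h.1
  have hG := h.2.1
  have hS : MemLp (fun x => (ν + nuT Cs δ (G x)) • G x) (3 / 2) (volume.restrict Ω) := by
    have h1 : MemLp (fun x => ν + nuT Cs δ (G x)) 3 (volume.restrict Ω) :=
      (memLp_const ν).add (hG.norm.const_mul ((Cs * δ) ^ 2))
    exact (ContinuousLinearMap.lsmul ℝ ℝ).memLp_of_bilin (3 / 2) h1 hG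
  have i1 := integrable_inner_of_memLp_two hwt (hw.mono_exponent (by norm_num : (2 : ℝ≥0∞) ≤ 3))
  have i2 := (integrable_inner_of_memLp_two hA
    (memLp_aCoef_smul (ν := ν) (Cs := Cs) (δ := δ) hν hG hw)).const_mul (β ^ 2)
  have hconv : MemLp (fun x => convection (w x) (G x)) (3 / 2) (volume.restrict Ω) := by
    simpa only [convectionL_apply] using convectionL.memLp_of_bilin (3 / 2) hw hG
  have i3 := integrable_inner_of_memLp_three hconv hw
  have i4 := integrable_inner_of_memLp_three hDp hw
  have i5 := integrable_inner_of_memLp_three hk hw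
  have e1 : ∫ x in Ω, dissDensity ν Cs δ (G x) = -∫ x in Ω, inner ℝ (k x) (w x) := by
    rw [← h.integral_inner_weakDiv hS hk hvisc]
    simp only [real_inner_smul_left, dissDensity]
  have e2 : ∫ x in Ω, inner ℝ (f x) (w x) = ∫ x in Ω, (inner ℝ (wt x) (w x) +
      β ^ 2 * inner ℝ (A x) (aCoef ν Cs δ (G x) • w x) +
      inner ℝ (convection (w x) (G x)) (w x) + inner ℝ (Dp x) (w x) - inner ℝ (k x) (w x)) := by
    refine integral_congr_ae ?_
    filter_upwards [heq] with x hx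
    rw [← hx]
    simp only [inner_add_left, inner_sub_left, real_inner_smul_left, real_inner_smul_right]
    ring
  have i12 : Integrable (fun x => inner ℝ (wt x) (w x) +
      β ^ 2 * inner ℝ (A x) (aCoef ν Cs δ (G x) • w x)) (volume.restrict Ω) := i1.add i2
  have i123 : Integrable (fun x => inner ℝ (wt x) (w x) +
      β ^ 2 * inner ℝ (A x) (aCoef ν Cs δ (G x) • w x) +
      inner ℝ (convection (w x) (G x)) (w x)) (volume.restrict Ω) := i12.add i3
  have i1234 : Integrable (fun x => inner ℝ (wt x) (w x) +
      β ^ 2 * inner ℝ (A x) (aCoef ν Cs δ (G x) • w x) +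
      inner ℝ (convection (w x) (G x)) (w x) + inner ℝ (Dp x) (w x)) (volume.restrict Ω) :=
    i123.add i4
  rw [e2, integral_sub i1234 i5, integral_add i123 i4, integral_add i12 i3, integral_add i1 i2,
    integral_const_mul,
    h.integral_convection_eq_zero hdiv,
    h.integral_inner_grad_pressure_eq_zero hdiv hp hDp hgrad, e1]
  ring

end Smagorinsky

/-! ### Mixed Lebesgue spaces and the energy balance in time. -/

namespace Smagorinsky

variable {d : ℕ} {F : Type*} [NormedAddCommGroup F]

theorem aemeasurable_eLpNorm_section {Y X : Type*} [MeasurableSpace Y] [MeasurableSpace X]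
    {τ : Measure Y} {μ : Measure X} [SFinite μ] {u : Y → X → F} {q : ℝ≥0∞} (hq0 : q ≠ 0)
    (hq : q ≠ ⊤) (hu : AEStronglyMeasurable (fun z : Y × X => u z.1 z.2) (τ.prod μ)) :
    AEMeasurable (fun t => eLpNorm (u t) q μ) τ := by
  simp_rw [eLpNorm_eq_lintegral_rpow_enorm_toReal hq0 hq]
  exact ((hu.enorm.pow_const _).lintegral_prod_right').pow_const _

theorem eLpNorm_prod_pow {Y X : Type*} [MeasurableSpace Y] [MeasurableSpace X]
    {τ : Measure Y} {μ : Measure X} [SFinite μ] {u : Y → X → F} {q : ℝ≥0∞} (hq0 : q ≠ 0)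
    (hq : q ≠ ⊤) (hu : AEStronglyMeasurable (fun z : Y × X => u z.1 z.2) (τ.prod μ)) :
    ∫⁻ z, ‖u z.1 z.2‖ₑ ^ q.toReal ∂(τ.prod μ) = ∫⁻ t, eLpNorm (u t) q μ ^ q.toReal ∂τ := by
  rw [lintegral_prod _ (hu.enorm.pow_const _)]
  refine lintegral_congr fun t => ?_
  have : q.toReal ≠ 0 := (ENNReal.toReal_pos hq0 hq).ne'
  rw [eLpNorm_eq_lintegral_rpow_enorm_toReal hq0 hq, ← ENNReal.rpow_mul, one_div,
    inv_mul_cancel₀ this, ENNReal.rpow_one]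

section MemLpLq

variable {I : Set ℝ} {Ω : Set (Vec d)} {p q : ℝ≥0∞} {u : ℝ → Vec d → F}

theorem MemLpLq.ae_memLp (hp : p ≠ 0) (hq0 : q ≠ 0) (hq : q ≠ ⊤) (h : MemLpLq I Ω p q u) :
    ∀ᵐ t ∂volume.restrict I, MemLp (u t) q (volume.restrict Ω) := by
  have hfin : ∀ᵐ t ∂volume.restrict I, eLpNorm (u t) q (volume.restrict Ω) < ⊤ := by
    have hm := aemeasurable_eLpNorm_section hq0 hq h.1
    by_cases hpt : p = ⊤
    · have h2 := h.2
      rw [hpt, eLpNorm_exponent_top] at h2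
      filter_upwards [enorm_ae_le_eLpNormEssSup
        (fun t => eLpNorm (u t) q (volume.restrict Ω)) (volume.restrict I)] with t ht
      rw [enorm_eq_self] at ht
      exact ht.trans_lt h2
    · have h2 := (eLpNorm_lt_top_iff_lintegral_rpow_enorm_lt_top hp hpt).1 h.2
      simp only [enorm_eq_self] at h2
      filter_upwards [ae_lt_top' (hm.pow_const _) h2.ne] with t ht
      exact (ENNReal.rpow_lt_top_iff_of_pos (ENNReal.toReal_pos hp hpt)).1 ht
  filter_upwards [hfin, h.1.prodMk_left] with t h1 h2
  exact ⟨h2, h1⟩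

theorem Ioi_eq_iUnion_Ioo : Ioi (0 : ℝ) = ⋃ n : ℕ, Ioo (0 : ℝ) (n + 1) := by
  ext t
  simp only [mem_Ioi, mem_iUnion, mem_Ioo, exists_and_left, iff_self_and]
  intro _
  obtain ⟨n, hn⟩ := exists_nat_gt t
  exact ⟨n, hn.trans (by linarith)⟩

theorem ae_Ioi_of_ae_Ioo {P : ℝ → Prop}
    (h : ∀ T : ℝ, 0 < T → ∀ᵐ t ∂volume.restrict (Ioo 0 T), P t) :
    ∀ᵐ t ∂volume.restrict (Ioi (0 : ℝ)), P t := by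
  rw [Ioi_eq_iUnion_Ioo, ae_restrict_iUnion_iff]
  exact fun n => h _ (by positivity)

theorem ae_Ioo_of_ae_Ioi {P : ℝ → Prop} {T : ℝ}
    (h : ∀ᵐ t ∂volume.restrict (Ioi (0 : ℝ)), P t) : ∀ᵐ t ∂volume.restrict (Ioo 0 T), P t :=
  ae_mono (Measure.restrict_mono Ioo_subset_Ioi_self le_rfl) h

theorem LocMemLpLq.ae_memLp (hp : p ≠ 0) (hq0 : q ≠ 0) (hq : q ≠ ⊤) (h : LocMemLpLq Ω p q u) :
    ∀ᵐ t ∂volume.restrict (Ioi (0 : ℝ)), MemLp (u t) q (volume.restrict Ω) :=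
  ae_Ioi_of_ae_Ioo fun T hT => (h T hT).ae_memLp hp hq0 hq

theorem MemLpLq.mono_set {J : Set ℝ} (hJ : J ⊆ I) (h : MemLpLq I Ω p q u) :
    MemLpLq J Ω p q u :=
  ⟨h.1.mono_measure (Measure.prod_mono (Measure.restrict_mono hJ le_rfl) le_rfl),
    (eLpNorm_mono_measure _ (Measure.restrict_mono hJ le_rfl)).trans_lt h.2⟩

theorem MemLpLq.memLp_prod_of_top (hI : volume I ≠ ⊤) (hq0 : q ≠ 0) (hq : q ≠ ⊤)
    (h : MemLpLq I Ω ⊤ q u) :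
    MemLp (fun z : ℝ × Vec d => u z.1 z.2) q
      ((volume.restrict I).prod (volume.restrict Ω)) := by
  refine ⟨h.1, ?_⟩
  rw [eLpNorm_lt_top_iff_lintegral_rpow_enorm_lt_top hq0 hq, eLpNorm_prod_pow hq0 hq h.1]
  have h2 := h.2
  rw [eLpNorm_exponent_top] at h2
  set C := eLpNormEssSup (fun t => eLpNorm (u t) q (volume.restrict Ω)) (volume.restrict I)
  have hle : ∀ᵐ t ∂volume.restrict I,
      eLpNorm (u t) q (volume.restrict Ω) ^ q.toReal ≤ C ^ q.toReal := by
    filter_upwards [enorm_ae_le_eLpNormEssSup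
      (fun t => eLpNorm (u t) q (volume.restrict Ω)) (volume.restrict I)] with t ht
    rw [enorm_eq_self] at ht
    gcongr
  refine (lintegral_mono_ae hle).trans_lt ?_
  rw [lintegral_const, Measure.restrict_apply_univ]
  exact ENNReal.mul_lt_top (ENNReal.rpow_lt_top_of_nonneg (by simp) h2.ne) hI.lt_top

theorem MemLpLq.memLp_prod (hq0 : q ≠ 0) (hq : q ≠ ⊤) (h : MemLpLq I Ω q q u) :
    MemLp (fun z : ℝ × Vec d => u z.1 z.2) q
      ((volume.restrict I).prod (volume.restrict Ω)) := by
  refine ⟨h.1, ?_⟩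
  rw [eLpNorm_lt_top_iff_lintegral_rpow_enorm_lt_top hq0 hq, eLpNorm_prod_pow hq0 hq h.1]
  have h2 := (eLpNorm_lt_top_iff_lintegral_rpow_enorm_lt_top hq0 hq).1 h.2
  simpa only [enorm_eq_self] using h2

theorem MemLpLq.exists_integral_norm_pow_le {n : ℕ} (hn : n ≠ 0) (h : MemLpLq I Ω ⊤ n u) :
    ∃ C : ℝ, 0 ≤ C ∧ ∀ᵐ t ∂volume.restrict I, ∫ x in Ω, ‖u t x‖ ^ n ≤ C := by
  have h2 := h.2
  rw [eLpNorm_exponent_top] at h2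
  set C := eLpNormEssSup (fun t => eLpNorm (u t) n (volume.restrict Ω)) (volume.restrict I)
  refine ⟨(C ^ n).toReal, by positivity, ?_⟩
  filter_upwards [h.ae_memLp (by simp) (by simpa using hn) (by simp), enorm_ae_le_eLpNormEssSup
      (fun t => eLpNorm (u t) n (volume.restrict Ω)) (volume.restrict I)] with t h3 h4
  rw [enorm_eq_self] at h4
  rw [← ENNReal.ofReal_le_iff_le_toReal (ENNReal.pow_ne_top h2.ne),
    ofReal_integral_norm_pow hn h3]
  gcongr

theorem memLpLq_top_two_of_bound {C : ℝ}
    (hm : ∀ T : ℝ, 0 < T → AEStronglyMeasurable (fun z : ℝ × Vec d => u z.1 z.2)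
      ((volume.restrict (Ioo 0 T)).prod (volume.restrict Ω)))
    (hu : ∀ᵐ t ∂volume.restrict (Ioi (0 : ℝ)), MemLp (u t) 2 (volume.restrict Ω))
    (hC : ∀ᵐ t ∂volume.restrict (Ioi (0 : ℝ)), ∫ x in Ω, ‖u t x‖ ^ 2 ≤ C) :
    MemLpLq (Ioi 0) Ω ⊤ 2 u := by
  constructor
  · rw [Measure.prod_restrict, Ioi_eq_iUnion_Ioo, iUnion_prod_const, aestronglyMeasurable_iUnion_iff]
    intro n
    rw [← Measure.prod_restrict]
    exact hm _ (by positivity)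
  · rw [eLpNorm_exponent_top]
    refine (eLpNormEssSup_le_of_ae_enorm_bound
      (C := ENNReal.ofReal C ^ (1 / (2 : ℝ))) ?_).trans_lt
      (ENNReal.rpow_lt_top_of_nonneg (by norm_num) ENNReal.ofReal_ne_top)
    filter_upwards [hu, hC] with t h1 h2
    have h3 := ENNReal.ofReal_le_ofReal h2
    rw [ofReal_integral_norm_pow two_ne_zero (by exact_mod_cast h1), Nat.cast_ofNat] at h3
    rw [enorm_eq_self, one_div, ENNReal.le_rpow_inv_iff (by norm_num)]
    exact_mod_cast h3

end MemLpLq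

/-- The energy balance of a function with a time derivative in `L²`. -/
theorem HasTimeDeriv.norm_sq_balance {Ω : Set (Vec d)} [IsFiniteMeasure (volume.restrict Ω)]
    {u₀ : Vec d → Vec d} {u ut : ℝ → Vec d → Vec d} (h : HasTimeDeriv Ω u₀ u ut)
    (hu : ∀ T : ℝ, 0 < T → MemLp (fun z : ℝ × Vec d => u z.1 z.2) 2
      ((volume.restrict (Ioo 0 T)).prod (volume.restrict Ω))) :
    (∀ T, 0 ≤ T → 0 ≤ (∫ x in Ω, ‖u₀ x‖ ^ 2) +
      2 * ∫ s in (0 : ℝ)..T, ∫ x in Ω, inner ℝ (ut s x) (u s x)) ∧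
    ∀ᵐ T ∂volume.restrict (Ioi (0 : ℝ)), ∫ x in Ω, ‖u T x‖ ^ 2 = (∫ x in Ω, ‖u₀ x‖ ^ 2) +
      2 * ∫ s in (0 : ℝ)..T, ∫ x in Ω, inner ℝ (ut s x) (u s x) := by
  obtain ⟨h0, hut, hae⟩ := h
  have key := fun T (hT : (0 : ℝ) < T) => integral_norm_sq_eq_of_primitive hT h0
    ((hut T hT).memLp_prod (by simp) (by simp)) (hu T hT) (ae_Ioo_of_ae_Ioi hae)
  refine ⟨fun T hT => ?_, ?_⟩
  · rcases hT.eq_or_lt with rfl | hT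
    · rw [intervalIntegral.integral_same]; positivity
    -- Valid at every `T`, not only almost every one, because the expression is the integral of the
    -- squared primitive.
    · rw [← key T hT]; positivity
  · filter_upwards [hae, ae_restrict_mem measurableSet_Ioi] with T h1 hT
    rw [← key T hT]
    refine integral_congr_ae ?_
    filter_upwards [h1] with x hx
    rw [hx]

theorem intervalIntegrable_of_integrable_prod {X : Type*} [MeasurableSpace X] {μ : Measure X}
    [SFinite μ] {g : ℝ × X → ℝ} {T : ℝ} (hT : 0 < T)
    (hg : Integrable g ((volume.restrict (Ioo 0 T)).prod μ)) :
    IntervalIntegrable (fun t => ∫ x, g (t, x) ∂μ) volume 0 T := by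
  rw [intervalIntegrable_iff_integrableOn_Ioo_of_le hT.le]
  exact hg.integral_prod_left

end Smagorinsky

/-! ### Estimates at a fixed time, time averages and generalized limits. -/

namespace Smagorinsky

variable {d : ℕ}

section FixedTime

variable {X : Type*} [MeasurableSpace X] {μ : Measure X}
  {ν Cs δ : ℝ} {G : X → Tensor d} {v g : X → Vec d}

theorem integral_norm_sq_le [IsFiniteMeasure μ] (hv : MemLp v 3 μ) :
    ∫ x, ‖v x‖ ^ 2 ∂μ ≤ μ.real univ + ∫ x, ‖v x‖ ^ 3 ∂μ := by
  have h3 := hv.integrable_norm_pow (p := 3) (by norm_num)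
  have h2 := (hv.mono_exponent (by norm_num : (2 : ℝ≥0∞) ≤ 3)).integrable_norm_pow (p := 2)
    (by norm_num)
  have := integral_mono h2 ((integrable_const (1 : ℝ)).add h3)
    fun x => sq_le_one_add_cube (norm_nonneg (v x))
  simp only [Pi.add_apply] at this
  rwa [integral_add (integrable_const 1) h3, integral_const, smul_eq_mul, mul_one] at this

theorem integral_norm_aCoef_smul_sq_le (hν : 0 < ν) (hG : MemLp G 3 μ) (hv : MemLp v 3 μ) :
    ∫ x, ‖aCoef ν Cs δ (G x) • v x‖ ^ 2 ∂μ ≤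
      ν⁻¹ * (Cs * δ) ^ 2 * (∫ x, ‖G x‖ ^ 3 ∂μ + ∫ x, ‖v x‖ ^ 3 ∂μ) := by
  have h3 := hv.integrable_norm_pow (p := 3) (by norm_num)
  have g3 := hG.integrable_norm_pow (p := 3) (by norm_num)
  rw [← integral_add g3 h3, ← integral_const_mul]
  exact integral_mono ((memLp_aCoef_smul hν hG hv).integrable_norm_pow (by norm_num))
    ((g3.add h3).const_mul _) fun x => norm_aCoef_smul_sq_le hν (G x) (v x)

theorem mul_integral_norm_cube_le_integral_dissDensity [IsFiniteMeasure μ] (hν : 0 < ν)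
    (hG : MemLp G 3 μ) :
    (Cs * δ) ^ 2 * ∫ x, ‖G x‖ ^ 3 ∂μ ≤ ∫ x, dissDensity ν Cs δ (G x) ∂μ := by
  rw [← integral_const_mul]
  refine integral_mono ((hG.integrable_norm_pow (by norm_num)).const_mul _)
    (integrable_dissDensity hG) fun x => ?_
  simp only [dissDensity_eq]
  nlinarith [mul_nonneg hν.le (sq_nonneg ‖G x‖)]

theorem integral_dissDensity_le [IsFiniteMeasure μ] (hν : 0 < ν) (hG : MemLp G 3 μ) :
    ∫ x, dissDensity ν Cs δ (G x) ∂μ ≤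
      ν * μ.real univ + (ν + (Cs * δ) ^ 2) * ∫ x, ‖G x‖ ^ 3 ∂μ := by
  have g3 := hG.integrable_norm_pow (p := 3) (by norm_num)
  have := integral_mono (integrable_dissDensity hG)
    ((integrable_const ν).add (g3.const_mul (ν + (Cs * δ) ^ 2)))
    fun x => dissDensity_le (Cs := Cs) (δ := δ) hν (G x)
  simp only [Pi.add_apply] at this
  rwa [integral_add (integrable_const ν) (g3.const_mul _), integral_const, integral_const_mul,
    smul_eq_mul, mul_comm (μ.real univ)] at this

/-- Cauchy–Schwarz and Young. The free parameter `s` lets the velocity term be absorbed by the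
dissipation. -/
theorem abs_integral_inner_le (hg : MemLp g 2 μ) (hv : MemLp v 2 μ) {s : ℝ} (hs : 0 < s) :
    |∫ x, inner ℝ (g x) (v x) ∂μ| ≤
      s⁻¹ / 2 * ∫ x, ‖g x‖ ^ 2 ∂μ + s / 2 * ∫ x, ‖v x‖ ^ 2 ∂μ := by
  have g2 := hg.integrable_norm_pow (p := 2) (by norm_num)
  have v2 := hv.integrable_norm_pow (p := 2) (by norm_num)
  rw [← integral_const_mul, ← integral_const_mul,
    ← integral_add (g2.const_mul _) (v2.const_mul _), ← Real.norm_eq_abs]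
  refine (norm_integral_le_integral_norm _).trans (integral_mono
    (integrable_inner_of_memLp_two hg hv).norm ((g2.const_mul _).add (v2.const_mul _)) fun x => ?_)
  refine (norm_inner_le_norm _ _).trans ?_
  have h := sq_nonneg (‖g x‖ - s * ‖v x‖)
  have e : s⁻¹ / 2 * ‖g x‖ ^ 2 + s / 2 * ‖v x‖ ^ 2 - ‖g x‖ * ‖v x‖ =
      s⁻¹ / 2 * (‖g x‖ - s * ‖v x‖) ^ 2 := by
    field_simp; ring
  have : 0 ≤ s⁻¹ / 2 * (‖g x‖ - s * ‖v x‖) ^ 2 := by positivity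
  change ‖g x‖ * ‖v x‖ ≤ s⁻¹ / 2 * ‖g x‖ ^ 2 + s / 2 * ‖v x‖ ^ 2
  linarith

end FixedTime

section Averages

theorem integral_le_of_ae_le {g : ℝ → ℝ} {C T : ℝ} (hT : 0 ≤ T)
    (hg : IntervalIntegrable g volume 0 T)
    (h : ∀ᵐ t ∂volume.restrict (Ioo 0 T), g t ≤ C) : ∫ t in (0 : ℝ)..T, g t ≤ C * T := by
  have h1 : ∀ᵐ t ∂volume.restrict (Ioc 0 T), g t ≤ C := by
    rwa [← restrict_Ioo_eq_restrict_Ioc]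
  rw [intervalIntegral.integral_of_le hT]
  refine (integral_mono_ae hg.1 (integrable_const C) h1).trans ?_
  simp [hT, mul_comm]

theorem abs_average_le {g : ℝ → ℝ} {C T : ℝ} (hT : 0 < T)
    (hg : IntervalIntegrable g volume 0 T)
    (h : ∀ᵐ t ∂volume.restrict (Ioo 0 T), |g t| ≤ C) :
    |1 / T * ∫ t in (0 : ℝ)..T, g t| ≤ C := by
  have h1 := integral_le_of_ae_le hT.le hg (h.mono fun t ht => (le_abs_self _).trans ht)
  have h2 := integral_le_of_ae_le hT.le hg.neg (h.mono fun t ht => (neg_le_abs _).trans ht)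
  simp only [Pi.neg_apply, intervalIntegral.integral_neg] at h2
  rw [abs_mul, abs_of_pos (by positivity), one_div, inv_mul_le_iff₀ hT, mul_comm]
  exact abs_le'.2 ⟨h1, h2⟩

/-- Time averages of the input `P` and the dissipation `D` for a bounded energy `e`. -/
theorem averages_of_energy_balance {e P D : ℝ → ℝ} {M C C₁ : ℝ}
    (hP : ∀ T, 0 ≤ T → IntervalIntegrable P volume 0 T)
    (hD : ∀ T, 0 ≤ T → IntervalIntegrable D volume 0 T)
    (he : ∀ T, 0 ≤ T → e T = e 0 + ∫ t in (0 : ℝ)..T, (P t - D t))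
    (he0 : ∀ T, 0 ≤ T → 0 ≤ e T) (heM : ∀ T, 0 ≤ T → e T ≤ M)
    (hPC : ∀ᵐ t ∂volume.restrict (Ioi (0 : ℝ)), |P t| ≤ C)
    (hD0 : ∀ᵐ t ∂volume.restrict (Ioi (0 : ℝ)), 0 ≤ D t)
    (hD1 : ∀ᵐ t ∂volume.restrict (Ioo (0 : ℝ) 1), D t ≤ C₁) :
    (∃ K, ∀ T, 0 < T → |1 / T * ∫ t in (0 : ℝ)..T, D t| ≤ K ∧
      |1 / T * ∫ t in (0 : ℝ)..T, P t| ≤ K) ∧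
    Tendsto (fun T => 1 / T * (∫ t in (0 : ℝ)..T, D t) - 1 / T * ∫ t in (0 : ℝ)..T, P t)
      atTop (𝓝 0) := by
  have hM : 0 ≤ M := (he0 0 le_rfl).trans (heM 0 le_rfl)
  have hPavg : ∀ T, 0 < T → |1 / T * ∫ t in (0 : ℝ)..T, P t| ≤ C := fun T hT =>
    abs_average_le hT (hP T hT.le) (ae_Ioo_of_ae_Ioi hPC)
  have hbal : ∀ T, 0 ≤ T →
      ∫ t in (0 : ℝ)..T, D t = e 0 - e T + ∫ t in (0 : ℝ)..T, P t := by
    intro T hT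
    rw [he T hT, intervalIntegral.integral_sub (hP T hT) (hD T hT)]; ring
  have hDn : ∀ T, 0 ≤ T → 0 ≤ ∫ t in (0 : ℝ)..T, D t := by
    intro T hT
    rw [intervalIntegral.integral_of_le hT]
    exact integral_nonneg_of_ae
      (ae_mono (Measure.restrict_mono Ioc_subset_Ioi_self le_rfl) hD0)
  refine ⟨⟨max C₁ (M + C), fun T hT => ⟨?_, ?_⟩⟩, ?_⟩
  · rw [abs_of_nonneg (mul_nonneg (by positivity) (hDn T hT.le)), one_div, inv_mul_le_iff₀ hT,
      mul_comm]
    -- Energy differences divided by `T` are not controlled near `T = 0`, so short times use the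
    -- bound on `D` over `(0, 1)`; for `T ≥ 1` the balance gives `M + C`.
    rcases le_total T 1 with h | h
    · refine (integral_le_of_ae_le hT.le (hD T hT.le)
        (ae_mono (Measure.restrict_mono (Ioo_subset_Ioo_right h) le_rfl) hD1)).trans ?_
      gcongr
      exact le_max_left _ _
    · have h1 := (le_abs_self _).trans (hPavg T hT)
      rw [one_div, inv_mul_le_iff₀ hT] at h1
      calc ∫ t in (0 : ℝ)..T, D t ≤ (M + C) * T := by
            rw [hbal T hT.le]
            nlinarith [heM 0 le_rfl, he0 T hT.le, mul_le_mul_of_nonneg_left h hM]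
        _ ≤ _ := by gcongr; exact le_max_right _ _
  · exact (hPavg T hT).trans ((le_add_of_nonneg_left hM).trans (le_max_right _ _))
  -- The difference of the averages is `(e 0 - e T) / T`, and both energies lie in `[0, M]`.
  · have h0 : Tendsto (fun T : ℝ => M * T⁻¹) atTop (𝓝 0) := by
      simpa using tendsto_inv_atTop_zero.const_mul M
    refine squeeze_zero_norm' ?_ h0
    filter_upwards [eventually_gt_atTop 0] with T hT
    rw [← mul_sub, hbal T hT.le, add_sub_cancel_right, norm_mul, one_div, norm_inv,
      Real.norm_of_nonneg hT.le, mul_comm]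
    gcongr
    rw [Real.norm_eq_abs, abs_le]
    constructor <;> linarith [heM 0 le_rfl, he0 T hT.le, heM T hT.le, he0 0 le_rfl]

/-- By linearity only the difference needs an ordinary limit; neither average has to converge. -/
theorem GeneralizedLimit.eq_of_tendsto_sub (LIM : GeneralizedLimit) {g h : ℝ≥0 → ℝ}
    (hg : g ∈ boundedFunctions) (hh : h ∈ boundedFunctions)
    (hgh : Tendsto (fun T => g T - h T) atTop (𝓝 0)) :
    LIM.toLinearMap ⟨g, hg⟩ = LIM.toLinearMap ⟨h, hh⟩ := by
  rw [← sub_eq_zero, ← map_sub]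
  exact LIM.eq_of_tendsto _ 0 hgh

/-- The domain `[0, ∞)` contains `T = 0`, where a time average takes the default value `0`. -/
theorem mem_boundedFunctions_of_bound {F : ℝ → ℝ} {K : ℝ} (h : ∀ T, 0 < T → |F T| ≤ K)
    (h0 : F 0 = 0) : (fun T : ℝ≥0 => F T) ∈ boundedFunctions := by
  refine ⟨K, fun T => ?_⟩
  rcases eq_or_lt_of_le T.2 with hT | hT
  · have : (T : ℝ) = 0 := hT.symm
    simp only [this, h0, abs_zero]
    exact (abs_nonneg _).trans (h 1 one_pos)
  · exact h T hT

theorem ereal_liminf_limsup_bounds {F : ℝ → ℝ} {c K : ℝ} (hlow : ∀ T, 0 < T → -(c * T⁻¹) ≤ F T)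
    (hup : ∀ T, 1 ≤ T → F T ≤ K) :
    0 ≤ liminf (fun T : ℝ => (F T : EReal)) atTop ∧
    liminf (fun T : ℝ => (F T : EReal)) atTop ≤ limsup (fun T : ℝ => (F T : EReal)) atTop ∧
    limsup (fun T : ℝ => (F T : EReal)) atTop < ⊤ := by
  refine ⟨?_, liminf_le_limsup, ?_⟩
  · have h0 : Tendsto (fun T : ℝ => -(c * T⁻¹)) atTop (𝓝 0) := by
      simpa using (tendsto_inv_atTop_zero.const_mul c).neg
    have h1 : Tendsto (fun T : ℝ => ((-(c * T⁻¹) : ℝ) : EReal)) atTop (𝓝 ((0 : ℝ) : EReal)) :=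
      (continuous_coe_real_ereal.tendsto 0).comp h0
    rw [← EReal.coe_zero, ← h1.liminf_eq]
    refine liminf_le_liminf ?_
    filter_upwards [eventually_gt_atTop 0] with T hT
    exact EReal.coe_le_coe_iff.2 (hlow T hT)
  · refine (limsup_le_of_le (a := (K : EReal)) (by isBoundedDefault) ?_).trans_lt
      (EReal.coe_lt_top K)
    filter_upwards [eventually_ge_atTop 1] with T hT
    exact EReal.coe_le_coe_iff.2 (hup T hT)

end Averages

end Smagorinsky

/-! ### The main theorem. -/

open Smagorinsky

theorem theorem3p2 {d : ℕ} (Ω : Set (Smagorinsky.Vec d)) (hΩ : IsOpen Ω)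
    (hΩb : Bornology.IsBounded Ω) (ν Cs δ β : ℝ) (hν : 0 < ν) (hCs : 0 < Cs) (hδ : 0 < δ)
    (hβ : 0 < β)
    (f : ℝ → Smagorinsky.Vec d → Smagorinsky.Vec d)
    (hf : Smagorinsky.MemLpLq (Ioi 0) Ω ⊤ 2 f)
    (w₀ : Smagorinsky.Vec d → Smagorinsky.Vec d) (hw₀ : MemLp w₀ 2 (volume.restrict Ω))
    (w : ℝ → Smagorinsky.Vec d → Smagorinsky.Vec d)
    (Dw : ℝ → Smagorinsky.Vec d → Smagorinsky.Tensor d)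
    (Daw : ℝ → Smagorinsky.Vec d → Smagorinsky.Vec d)
    (hw : Smagorinsky.IsStrongSolution Ω ν Cs δ β f w₀ w Dw Daw) :
    -- the energy input, the total dissipation and the model dissipation are well defined
    (∀ T : ℝ, 0 < T →
      IntegrableOn (fun z : ℝ × Smagorinsky.Vec d => inner ℝ (f z.1 z.2) (w z.1 z.2))
        (Ioo 0 T ×ˢ Ω) ∧
      IntegrableOn (fun z : ℝ × Smagorinsky.Vec d =>
        Smagorinsky.dissDensity ν Cs δ (Dw z.1 z.2)) (Ioo 0 T ×ˢ Ω) ∧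
      IntegrableOn (fun z : ℝ × Smagorinsky.Vec d =>
        Smagorinsky.mdDensity ν Cs δ β (Dw z.1 z.2) (w z.1 z.2) (Daw z.1 z.2))
        (Ioo 0 T ×ˢ Ω)) ∧
    -- `w` and `a(w) w` belong to `L^∞(0,∞; L²(Ω))`
    Smagorinsky.MemLpLq (Ioi 0) Ω ⊤ 2 w ∧
    Smagorinsky.MemLpLq (Ioi 0) Ω ⊤ 2
      (fun t x => Smagorinsky.aCoef ν Cs δ (Dw t x) • w t x) ∧
    -- the time averaged total dissipation is bounded uniformly in `T`
    (∃ C : ℝ, ∀ T : ℝ, 0 < T →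
      Smagorinsky.timeAvg Ω (fun t x => Smagorinsky.dissDensity ν Cs δ (Dw t x)) T ≤ C) ∧
    -- balance of energy input and dissipation under every generalized limit
    (∃ (hD : (fun T : ℝ≥0 => Smagorinsky.timeAvg Ω
          (fun t x => Smagorinsky.dissDensity ν Cs δ (Dw t x)) (T : ℝ))
            ∈ Smagorinsky.boundedFunctions)
        (hI : (fun T : ℝ≥0 => Smagorinsky.timeAvg Ω (fun t x => inner ℝ (f t x) (w t x)) (T : ℝ))
            ∈ Smagorinsky.boundedFunctions),
      ∀ LIM : Smagorinsky.GeneralizedLimit,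
        LIM.toLinearMap ⟨_, hD⟩ = LIM.toLinearMap ⟨_, hI⟩) ∧
    -- the time averaged model dissipation
    0 ≤ liminf (fun T : ℝ => ((Smagorinsky.timeAvg Ω (fun t x =>
        Smagorinsky.mdDensity ν Cs δ β (Dw t x) (w t x) (Daw t x)) T : ℝ) : EReal)) atTop ∧
    liminf (fun T : ℝ => ((Smagorinsky.timeAvg Ω (fun t x =>
        Smagorinsky.mdDensity ν Cs δ β (Dw t x) (w t x) (Daw t x)) T : ℝ) : EReal)) atTop ≤
      limsup (fun T : ℝ => ((Smagorinsky.timeAvg Ω (fun t x =>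
        Smagorinsky.mdDensity ν Cs δ β (Dw t x) (w t x) (Daw t x)) T : ℝ) : EReal)) atTop ∧
    limsup (fun T : ℝ => ((Smagorinsky.timeAvg Ω (fun t x =>
        Smagorinsky.mdDensity ν Cs δ β (Dw t x) (w t x) (Daw t x)) T : ℝ) : EReal)) atTop < ⊤ := by
  obtain ⟨R, hR0, hR⟩ := hΩb.subset_closedBall_lt 0 0
  have hfin : IsFiniteMeasure (volume.restrict Ω) :=
    isFiniteMeasure_restrict.2 hΩb.measure_lt_top.ne
  obtain ⟨z₀, hz⟩ := hw.aw_deriv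
  obtain ⟨wt, p, Dp, k, hwt, hp, hDp, hk, hgrad, hvisc, hmom⟩ := hw.momentum
  have hIoo : ∀ T : ℝ, volume (Ioo 0 T) ≠ ⊤ := fun T => by simp
  -- integrability on bounded space-time cylinders
  have hw3 := fun T hT => (hw.w_mem T hT).memLp_prod_of_top (hIoo T) (by simp) (by simp)
  have hG3 := fun T hT => (hw.Dw_mem T hT).memLp_prod_of_top (hIoo T) (by simp) (by simp)
  have hw2 := fun T hT => (hw3 T hT).mono_exponent (by norm_num : (2 : ℝ≥0∞) ≤ 3)
  have hf2 := fun T : ℝ => (hf.mono_set (Ioo_subset_Ioi_self : Ioo 0 T ⊆ _)).memLp_prod_of_top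
    (hIoo T) (by simp) (by simp)
  have hA2 := fun T hT => (hz.2.1 T hT).memLp_prod (by simp) (by simp)
  have hwt2 := fun T hT => (hwt.2.1 T hT).memLp_prod (by simp) (by simp)
  have hz2 := fun T hT => memLp_aCoef_smul (ν := ν) (Cs := Cs) (δ := δ) hν (hG3 T hT) (hw3 T hT)
  have iP := fun T hT => integrable_inner_of_memLp_two (hf2 T) (hw2 T hT)
  have iD := fun T hT => integrable_dissDensity (ν := ν) (Cs := Cs) (δ := δ) (hG3 T hT)
  have iM := fun T hT => integrable_mdDensity (ν := ν) (Cs := Cs) (δ := δ) (β := β) hν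
    (hG3 T hT) (hw3 T hT) (hA2 T hT)
  have iA := fun T hT => integrable_inner_of_memLp_two (hwt2 T hT) (hw2 T hT)
  have iB := fun T hT => integrable_inner_of_memLp_two (hA2 T hT) (hz2 T hT)
  have toInt : ∀ {g : ℝ × Vec d → ℝ}, (∀ T, 0 < T →
      Integrable g ((volume.restrict (Ioo 0 T)).prod (volume.restrict Ω))) →
      ∀ T, 0 ≤ T → IntervalIntegrable (fun t => ∫ x in Ω, g (t, x)) volume 0 T := by
    intro g hg T hT
    rcases hT.eq_or_lt with rfl | hT
    · exact IntervalIntegrable.refl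
    · exact intervalIntegrable_of_integrable_prod hT (hg T hT)
  set A : ℝ → ℝ := fun t => ∫ x in Ω, inner ℝ (wt t x) (w t x) with hA
  set B : ℝ → ℝ := fun t => ∫ x in Ω, inner ℝ (Daw t x) (aCoef ν Cs δ (Dw t x) • w t x) with hB
  set D : ℝ → ℝ := fun t => ∫ x in Ω, dissDensity ν Cs δ (Dw t x) with hD
  set P : ℝ → ℝ := fun t => ∫ x in Ω, inner ℝ (f t x) (w t x) with hP
  set Q : ℝ → ℝ := fun t => ∫ x in Ω, mdDensity ν Cs δ β (Dw t x) (w t x) (Daw t x) with hQ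
  set Y : ℝ → ℝ := fun t => ∫ x in Ω, ‖Dw t x‖ ^ 3 with hY
  have jA : ∀ T, 0 ≤ T → IntervalIntegrable A volume 0 T := toInt iA
  have jB : ∀ T, 0 ≤ T → IntervalIntegrable B volume 0 T := toInt iB
  have jD : ∀ T, 0 ≤ T → IntervalIntegrable D volume 0 T := toInt iD
  have jP : ∀ T, 0 ≤ T → IntervalIntegrable P volume 0 T := toInt iP
  have jQ : ∀ T, 0 ≤ T → IntervalIntegrable Q volume 0 T := toInt iM
  have jY : ∀ T, 0 ≤ T → IntervalIntegrable Y volume 0 T :=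
    toInt fun T hT => (hG3 T hT).integrable_norm_pow (by norm_num)
  -- the kinetic energies
  set nw : ℝ → ℝ := fun T => (∫ x in Ω, ‖w₀ x‖ ^ 2) + 2 * ∫ t in (0 : ℝ)..T, A t with hnw
  set nz : ℝ → ℝ := fun T => (∫ x in Ω, ‖z₀ x‖ ^ 2) + 2 * ∫ t in (0 : ℝ)..T, B t with hnz
  obtain ⟨nw0, nwae⟩ : (∀ T, 0 ≤ T → 0 ≤ nw T) ∧
      ∀ᵐ T ∂volume.restrict (Ioi (0 : ℝ)), ∫ x in Ω, ‖w T x‖ ^ 2 = nw T :=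
    hwt.norm_sq_balance hw2
  obtain ⟨nz0, nzae⟩ : (∀ T, 0 ≤ T → 0 ≤ nz T) ∧
      ∀ᵐ T ∂volume.restrict (Ioi (0 : ℝ)),
        ∫ x in Ω, ‖aCoef ν Cs δ (Dw T x) • w T x‖ ^ 2 = nz T := hz.norm_sq_balance hz2
  -- `nw` and `nz` equal the squared norms only almost everywhere, but they are primitives,
  -- nonnegative at every time. The weights make `e' = A + β² B`.
  set e : ℝ → ℝ := fun T => nw T / 2 + β ^ 2 / 2 * nz T with he
  have hw3t := LocMemLpLq.ae_memLp (by simp) (by simp) (by simp) hw.w_mem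
  have hG3t := LocMemLpLq.ae_memLp (by simp) (by simp) (by simp) hw.Dw_mem
  have hf2t := hf.ae_memLp (by simp) (by simp) (by simp)
  have hA2t := LocMemLpLq.ae_memLp (by simp) (by simp) (by simp) hz.2.1
  have h32 : (3 / 2 : ℝ≥0∞) ≠ ⊤ := ENNReal.div_ne_top (by simp) (by simp)
  have h32' : (3 / 2 : ℝ≥0∞) ≠ 0 := (one_pos.trans_le one_le_three_halves).ne'
  have hen : ∀ᵐ t ∂volume.restrict (Ioi (0 : ℝ)), A t + β ^ 2 * B t + D t = P t := by
    filter_upwards [hw.memW0, hw.div_free, hgrad, hvisc, hmom, hA2t,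
      LocMemLpLq.ae_memLp (by simp) (by simp) (by simp) hwt.2.1,
      LocMemLpLq.ae_memLp (by simp) h32' h32 hp, LocMemLpLq.ae_memLp (by simp) h32' h32 hDp,
      LocMemLpLq.ae_memLp (by simp) h32' h32 hk] with t h1 h2 h3 h4 h5 h6 h7 h8 h9 h10
    exact energy_identity hν h1 h2 h7 h6 h8 h9 h10 h3 h4 h5
  have hbal : ∀ T, 0 ≤ T → e T = e 0 + ∫ t in (0 : ℝ)..T, (P t - D t) := by
    intro T hT
    have h1 : ∫ t in (0 : ℝ)..T, (P t - D t) = ∫ t in (0 : ℝ)..T, (A t + β ^ 2 * B t) := by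
      refine intervalIntegral.integral_congr_ae_restrict ?_
      rw [uIoc_of_le hT]
      filter_upwards [ae_mono (Measure.restrict_mono Ioc_subset_Ioi_self le_rfl) hen] with t ht
      linarith
    rw [h1, intervalIntegral.integral_add (jA T hT) ((jB T hT).const_mul _),
      intervalIntegral.integral_const_mul]
    simp only [he, hnw, hnz, intervalIntegral.integral_same]
    ring
  -- differential inequality for the energy
  obtain ⟨Cf, hCf0, hCf⟩ := MemLpLq.exists_integral_norm_pow_le (n := 2) two_ne_zero
    (by exact_mod_cast hf)
  set m : ℝ := (volume.restrict Ω).real univ with hm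
  have hm0 : 0 ≤ m := measureReal_nonneg
  set κ : ℝ := 216 * R ^ 3 with hκ
  have hκ0 : 0 < κ := by positivity
  set c : ℝ := (Cs * δ) ^ 2 with hc
  have hc0 : 0 < c := by positivity
  have hY0 : ∀ t, 0 ≤ Y t := fun t => by positivity
  have hPY : ∀ᵐ t ∂volume.restrict (Ioi (0 : ℝ)), ∫ x in Ω, ‖w t x‖ ^ 3 ≤ κ * Y t := by
    filter_upwards [hw.memW0] with t h1
    exact h1.poincare hR0.le hR
  have hDY : ∀ᵐ t ∂volume.restrict (Ioi (0 : ℝ)), c * Y t ≤ D t := by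
    filter_upwards [hG3t] with t h1
    exact mul_integral_norm_cube_le_integral_dissDensity hν h1
  have hD0 : ∀ᵐ t ∂volume.restrict (Ioi (0 : ℝ)), 0 ≤ D t := by
    filter_upwards [hDY] with t h1
    exact (mul_nonneg hc0.le (hY0 t)).trans h1
  have hnwY : ∀ᵐ t ∂volume.restrict (Ioi (0 : ℝ)), nw t ≤ m + κ * Y t := by
    filter_upwards [hw3t, nwae, hPY] with t h1 h2 h3
    rw [← h2]
    exact (integral_norm_sq_le h1).trans (by gcongr)
  have hnzY : ∀ᵐ t ∂volume.restrict (Ioi (0 : ℝ)), nz t ≤ ν⁻¹ * c * ((1 + κ) * Y t) := by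
    filter_upwards [hw3t, hG3t, nzae, hPY] with t h1 h2 h3 h4
    rw [← h3]
    refine (integral_norm_aCoef_smul_sq_le hν h2 h1).trans ?_
    have : Y t + ∫ x in Ω, ‖w t x‖ ^ 3 ≤ (1 + κ) * Y t := by linarith
    gcongr
  have hPs : ∀ s : ℝ, 0 < s → ∀ᵐ t ∂volume.restrict (Ioi (0 : ℝ)),
      |P t| ≤ s⁻¹ / 2 * Cf + s / 2 * nw t := by
    intro s hs
    filter_upwards [hf2t, hw3t, nwae, hCf] with t h1 h2 h3 h4
    rw [← h3]
    exact (abs_integral_inner_le h1 (h2.mono_exponent (by norm_num)) hs).trans (by gcongr)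
  -- The coefficient of `Y` when the bounds for `nw` and `nz` are inserted in `e`: `e ≤ m / 2 + c₃
  -- Y`.
  set c₃ : ℝ := κ / 2 + β ^ 2 / 2 * (ν⁻¹ * c * (1 + κ)) with hc₃
  have hc₃0 : 0 < c₃ := by positivity
  -- Chosen so that `P` costs `s κ / 2 · Y = c / 2 · Y`, half of the lower bound `c Y` for `D`.
  set s : ℝ := c / κ with hs
  have hs0 : 0 < s := by positivity
  -- The other half pays for the decay: `α c₃ = c / 2`.
  set α : ℝ := c / (2 * c₃) with hα
  have hα0 : 0 < α := by positivity
  have hgrowth : ∀ᵐ t ∂volume.restrict (Ioi (0 : ℝ)),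
      P t - D t ≤ (s⁻¹ / 2 * Cf + s / 2 * m + α * (m / 2)) - α * e t := by
    filter_upwards [hPs s hs0, hDY, hnwY, hnzY] with t h1 h2 h3 h4
    have h5 : e t ≤ m / 2 + c₃ * Y t := by
      have := mul_le_mul_of_nonneg_left h4 (by positivity : 0 ≤ β ^ 2 / 2)
      simp only [he, hc₃]
      linarith
    have h6 : α * e t ≤ α * (m / 2) + c / 2 * Y t := by
      have h7 : α * c₃ = c / 2 := by rw [hα]; field_simp
      calc α * e t ≤ α * (m / 2 + c₃ * Y t) := by gcongr
        _ = α * (m / 2) + α * c₃ * Y t := by ring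
        _ = _ := by rw [h7]
    have h8 : s / 2 * nw t ≤ s / 2 * m + c / 2 * Y t := by
      have h9 : s * κ = c := by rw [hs]; field_simp
      calc s / 2 * nw t ≤ s / 2 * (m + κ * Y t) := by gcongr
        _ = s / 2 * m + s * κ / 2 * Y t := by ring
        _ = _ := by rw [h9]
    linarith [le_abs_self (P t)]
  obtain ⟨M, hM⟩ : ∃ M, ∀ T, 0 ≤ T → e T ≤ M :=
    ⟨_, fun T hT => le_max_of_growth_le hα0 (fun T hT => (jP T hT).sub (jD T hT)) hbal hgrowth hT⟩
  have he0 : ∀ T, 0 ≤ T → 0 ≤ e T := fun T hT => by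
    have := nw0 T hT
    have := nz0 T hT
    simp only [he]
    positivity
  have hnwM : ∀ T, 0 ≤ T → nw T ≤ 2 * M := fun T hT => by
    have h1 := hM T hT
    have h2 := mul_nonneg (by positivity : 0 ≤ β ^ 2 / 2) (nz0 T hT)
    simp only [he] at h1
    linarith
  have hnzM : ∀ T, 0 ≤ T → nz T ≤ (β ^ 2 / 2)⁻¹ * M := fun T hT => by
    have h1 := hM T hT
    have h2 := nw0 T hT
    simp only [he] at h1
    rw [le_inv_mul_iff₀ (by positivity)]
    linarith
  -- With `nw` bounded, absorption is no longer needed and the parameter `1` suffices.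
  have hPC : ∀ᵐ t ∂volume.restrict (Ioi (0 : ℝ)), |P t| ≤ 1⁻¹ / 2 * Cf + 1 / 2 * (2 * M) := by
    filter_upwards [hPs 1 one_pos, ae_restrict_mem measurableSet_Ioi] with t h1 h2
    exact h1.trans (by gcongr; exact hnwM t (le_of_lt h2))
  obtain ⟨CG, hCG0, hCG⟩ := MemLpLq.exists_integral_norm_pow_le (n := 3) three_ne_zero
    (by exact_mod_cast hw.Dw_mem 1 one_pos)
  have hD1 : ∀ᵐ t ∂volume.restrict (Ioo (0 : ℝ) 1), D t ≤ ν * m + (ν + c) * CG := by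
    filter_upwards [ae_Ioo_of_ae_Ioi hG3t, hCG] with t h1 h2
    exact (integral_dissDensity_le hν h1).trans (by gcongr)
  obtain ⟨⟨K, hK⟩, hlim⟩ := averages_of_energy_balance jP jD hbal he0 hM hPC hD0 hD1
  have hDb : (fun T : ℝ≥0 => timeAvg Ω (fun t x => dissDensity ν Cs δ (Dw t x)) (T : ℝ)) ∈
      boundedFunctions := mem_boundedFunctions_of_bound
    (F := timeAvg Ω (fun t x => dissDensity ν Cs δ (Dw t x))) (fun T hT => (hK T hT).1)
    (by simp [timeAvg])
  have hPb : (fun T : ℝ≥0 => timeAvg Ω (fun t x => inner ℝ (f t x) (w t x)) (T : ℝ)) ∈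
      boundedFunctions := mem_boundedFunctions_of_bound
    (F := timeAvg Ω (fun t x => inner ℝ (f t x) (w t x))) (fun T hT => (hK T hT).2)
    (by simp [timeAvg])
  -- the model dissipation
  have hQint : ∀ T, 0 ≤ T → ∫ t in (0 : ℝ)..T, Q t =
      β ^ 2 / 2 * (nz T - nz 0) + c * ∫ t in (0 : ℝ)..T, Y t := by
    intro T hT
    have h1 : ∫ t in (0 : ℝ)..T, Q t = ∫ t in (0 : ℝ)..T, (β ^ 2 * B t + c * Y t) := by
      refine intervalIntegral.integral_congr_ae_restrict ?_
      rw [uIoc_of_le hT]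
      filter_upwards [ae_mono (Measure.restrict_mono Ioc_subset_Ioi_self le_rfl) hw3t,
        ae_mono (Measure.restrict_mono Ioc_subset_Ioi_self le_rfl) hG3t,
        ae_mono (Measure.restrict_mono Ioc_subset_Ioi_self le_rfl) hA2t] with t h1 h2 h3
      simp only [hQ, hB, hY, mdDensity_eq]
      rw [integral_add, integral_const_mul, integral_const_mul]
      · exact (integrable_inner_of_memLp_two h3 (memLp_aCoef_smul hν h2 h1)).const_mul _
      · exact (h2.integrable_norm_pow (by norm_num)).const_mul _
    rw [h1, intervalIntegral.integral_add ((jB T hT).const_mul _) ((jY T hT).const_mul _),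
      intervalIntegral.integral_const_mul, intervalIntegral.integral_const_mul]
    simp only [hnz, intervalIntegral.integral_same]
    ring
  have hYint0 : ∀ T, 0 ≤ T → 0 ≤ ∫ t in (0 : ℝ)..T, Y t := fun T hT =>
    intervalIntegral.integral_nonneg hT fun t _ => hY0 t
  have hYD : ∀ T, 0 ≤ T → c * ∫ t in (0 : ℝ)..T, Y t ≤ ∫ t in (0 : ℝ)..T, D t := by
    intro T hT
    rw [← intervalIntegral.integral_const_mul, intervalIntegral.integral_of_le hT,
      intervalIntegral.integral_of_le hT]
    exact integral_mono_ae ((jY T hT).const_mul c).1 (jD T hT).1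
      (ae_mono (Measure.restrict_mono Ioc_subset_Ioi_self le_rfl) hDY)
  have hβz : ∀ T, 0 ≤ T → β ^ 2 / 2 * nz T ≤ M := fun T hT => by
    have h1 := hM T hT
    have h2 := nw0 T hT
    simp only [he] at h1
    linarith
  have hM0 : 0 ≤ M := (he0 0 le_rfl).trans (hM 0 le_rfl)
  have hmd := ereal_liminf_limsup_bounds
    (F := timeAvg Ω (fun t x => mdDensity ν Cs δ β (Dw t x) (w t x) (Daw t x)))
    (c := M) (K := M + K) (fun T hT => by
      change _ ≤ 1 / T * ∫ t in (0 : ℝ)..T, Q t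
      have h1 := hQint T hT.le
      have h2 := mul_nonneg (by positivity : 0 ≤ β ^ 2 / 2) (nz0 T hT.le)
      have h3 := mul_nonneg hc0.le (hYint0 T hT.le)
      -- The only negative contribution is the initial correction energy `β² / 2 * nz 0 ≤ M`, which
      -- vanishes after division by `T`.
      have h4 : -M ≤ ∫ t in (0 : ℝ)..T, Q t := by linarith [hβz 0 le_rfl]
      have h5 := mul_le_mul_of_nonneg_left h4 (by positivity : 0 ≤ 1 / T)
      calc -(M * T⁻¹) = 1 / T * -M := by ring
        _ ≤ _ := h5)
    (fun T hT => by
      change 1 / T * (∫ t in (0 : ℝ)..T, Q t) ≤ _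
      have hT0 : 0 < T := one_pos.trans_le hT
      have h1 := hQint T hT0.le
      have h2 := mul_nonneg (by positivity : 0 ≤ β ^ 2 / 2) (nz0 0 le_rfl)
      have h3 : ∫ t in (0 : ℝ)..T, Q t ≤ M + ∫ t in (0 : ℝ)..T, D t := by
        linarith [hβz T hT0.le, hYD T hT0.le]
      have h4 := mul_le_mul_of_nonneg_left h3 (by positivity : 0 ≤ 1 / T)
      have h5 : 1 / T * M ≤ M := by
        rw [one_div, inv_mul_le_iff₀ hT0]
        exact le_mul_of_one_le_left hM0 hT
      have h6 := (le_abs_self _).trans (hK T hT0).1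
      linarith)
  refine ⟨fun T hT => ⟨?_, ?_, ?_⟩, ?_, ?_, ⟨K, fun T hT => (le_abs_self _).trans (hK T hT).1⟩,
    ⟨hDb, hPb, fun LIM => LIM.eq_of_tendsto_sub hDb hPb ?_⟩, hmd.1, hmd.2.1, hmd.2.2⟩
  · rw [IntegrableOn, Measure.volume_eq_prod, ← Measure.prod_restrict]
    exact iP T hT
  · rw [IntegrableOn, Measure.volume_eq_prod, ← Measure.prod_restrict]
    exact iD T hT
  · rw [IntegrableOn, Measure.volume_eq_prod, ← Measure.prod_restrict]
    exact iM T hT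
  · refine memLpLq_top_two_of_bound (C := 2 * M) (fun T hT => (hw2 T hT).1)
      (hw3t.mono fun t ht => ht.mono_exponent (by norm_num)) ?_
    filter_upwards [nwae, ae_restrict_mem measurableSet_Ioi] with t h1 h2
    exact h1.le.trans (hnwM t (le_of_lt h2))
  · refine memLpLq_top_two_of_bound (C := (β ^ 2 / 2)⁻¹ * M) (fun T hT => (hz2 T hT).1)
      (hw3t.mp (hG3t.mono fun t h1 h2 => memLp_aCoef_smul hν h1 h2)) ?_
    filter_upwards [nzae, ae_restrict_mem measurableSet_Ioi] with t h1 h2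
    exact h1.le.trans (hnzM t (le_of_lt h2))
  · exact hlim.comp (NNReal.tendsto_coe_atTop.2 tendsto_id)
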